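/- For $|q|<1$ let $(z;q)_\infty=\prod_{j\ge 0}(1-zq^j)$. Let $f$ be the remainder in Stirling's formula, $$\log\Gamma(x)=\left(x-\tfrac12\right)\log x-x+\tfrac12\log(2\pi)+\tfrac1{12x}+f(x),\qquad x\in\mathbb C\setminus(-\infty,0],$$ where $\log x$ and $\log\Gamma(x)$ are the branches that are analytic there and real for $x>0$. Let $\operatorname{Re}\beta>0$. For $y\in\mathbb C\setminus 2\pi\mathrm i\mathbb Z$ and $n\in\mathbb Z$ put $x_n=(y+2\pi\mathrm i n)/\beta$, and take powers $x_n^{x_n-1/2}$ and logarithms of $x_n$ with the principal branch ($-\pi<\arg x_n\le\pi$). Let $\Omega_\beta$ be the set of all $y\in\mathbb C$ with $y\notin 2\pi\mathrm i\mathbb Z+\beta\mathbb R_{\le 0}$. Starting from $\operatorname{Re}y>0$, where $\operatorname{Li}_2(e^{-y})=\sum_{n\ge1}e^{-ny}/n^2$ and $\log(1-e^{-y})$ is the principal logarithm, both functions continue analytically to $\Omega_\beta$. Denote the continuations by $\operatorname{Li}_2(e^{-y})$ and $\log(1-e^{-y})$ again, let them take on the cuts, at points $y_0\notin 2\pi\mathrm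 i\mathbb Z$, their limits from the side $\operatorname{Im}((y-y_0)/\beta)>0$, and put $(1-e^{-y})^{1/2}=\exp\left(\tfrac12\log(1-e^{-y})\right)$. Then $\exp(\log(1-e^{-y}))=1-e^{-y}$ for all $y\notin2\pi\mathrm i\mathbb Z$, and the following holds. 1. For every $y\notin 2\pi\mathrm i\mathbb Z$ (with $1/\Gamma(x)=0$ for $x\in\mathbb Z_{\le0}$), $$(e^{-y};e^{-\beta})_\infty=\exp\left(\frac{\beta(1-\coth(y/2))}{24}-\frac{\operatorname{Li}_2(e^{-y})}{\beta}\right)(1-e^{-y})^{1/2}\prod_{n\in\mathbb Z}\left(\frac{\sqrt{2\pi}}{\Gamma(x_n)}\,x_n^{x_n-1/2}\,e^{\frac1{12x_n}-x_n}\right),$$ and the product converges absolutely (the sum of $|F_n-1|$ over its factors $F_n$ is finite). 2. For every $y\in\Omega_\beta$ the series $\sum_{k\ge0}\log(1-e^{-y-k\beta})$ and $\sum_{n\in\mathbb Z}f(x_n)$ converge absolutely, the first is a logarithm of $(e^{-y};e^{-\beta})_\infty$, the product in 1 equals $\exp\left(-\sum_{n\in\mathbb Z}f(x_n)\right)$,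 and $$\sum_{k=0}^\infty\log(1-e^{-y-k\beta})=-\frac{\operatorname{Li}_2(e^{-y})}{\beta}+\frac12\log(1-e^{-y})+\frac{\beta(1-\coth(y/2))}{24}-\sum_{n\in\mathbb Z}f(x_n).$$ 3. Let $y\notin 2\pi\mathrm i\mathbb Z$. If $\beta$ is real, or if $y$ is not of the form $2\pi\mathrm i n-a-b\beta$ with $n\in\mathbb Z$ and $a,b\ge0$ (for instance if $\operatorname{Re}y\ge0$), then the branches above are the principal ones, that is, $\log(1-e^{-y})$ is the principal logarithm and $\operatorname{Li}_2(e^{-y})$ is the value at $z=e^{-y}$ of $\operatorname{Li}_2(z)=-\int_0^1\frac{\log(1-tz)}{t}\,dt$ with the principal logarithm. So the identity in 1 holds with the principal branches of all functions. -/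

import Mathlib

noncomputable section

namespace QPoch

open Complex

/-- The infinite `q`-Pochhammer symbol `(z;q)_∞ = ∏_{j ≥ 0} (1 - z q^j)`. -/
def qPochhammer (z q : ℂ) : ℂ := ∏' j : ℕ, (1 - z * q ^ j)

/-- The dilogarithm series `∑_{n ≥ 1} z^n / n^2`, for `‖z‖ ≤ 1`. -/
def dilogSeries (z : ℂ) : ℂ := ∑' n : ℕ, z ^ (n + 1) / ((n : ℂ) + 1) ^ 2

/-- The principal branch of the dilogarithm, analytic outside `[1, ∞)`
(on the cut it takes the boundary values from below). -/
def dilog (z : ℂ) : ℂ := -∫ t in (0 : ℝ)..1, log (1 - (t : ℂ) * z) / (t : ℂ)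

/-- The hyperbolic cotangent. -/
def coth (z : ℂ) : ℂ := cosh z / sinh z

/-- The branch of `log Γ` on the plane cut along `(-∞, 0]` that is real on the positive axis,
given by the logarithm of the Weierstrass product of `Γ`. -/
def logGamma (x : ℂ) : ℂ :=
  -(Real.eulerMascheroniConstant : ℂ) * x - log x
    + ∑' n : ℕ, (x / ((n : ℂ) + 1) - log (1 + x / ((n : ℂ) + 1)))

/-- The remainder `f` in Stirling's formula
`log Γ(x) = (x - 1/2) log x - x + (1/2) log (2π) + 1/(12 x) + f x`. -/
def stirlingRemainder (x : ℂ) : ℂ :=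
  logGamma x
    - ((x - 1 / 2) * log x - x + (Real.log (2 * Real.pi) : ℂ) / 2 + 1 / (12 * x))

/-- The dressed reciprocal gamma function
`√(2π) / Γ(x) * x^(x - 1/2) * exp (1/(12 x) - x)`, with the principal branch of the power.
At the poles of `Γ` its value is `0`, in agreement with Mathlib's `Γ = 0` there. -/
def dressedInvGamma (x : ℂ) : ℂ :=
  (Real.sqrt (2 * Real.pi) : ℂ) / Gamma x * x ^ (x - 1 / 2) * exp (1 / (12 * x) - x)

/-- The points `x_n = (y + 2πin)/β`. -/
def node (β y : ℂ) (n : ℤ) : ℂ := (y + 2 * (Real.pi : ℂ) * I * (n : ℂ)) / β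

/-- The set `2πiℤ`. -/
def periods : Set ℂ := {y | ∃ n : ℤ, y = 2 * (Real.pi : ℂ) * I * (n : ℂ)}

/-- The complex plane with the rays `2πin + β ℝ_{≤ 0}`, `n ∈ ℤ`, removed. -/
def cutPlane (β : ℂ) : Set ℂ :=
  {y | ∀ (n : ℤ) (t : ℝ), 0 ≤ t → y ≠ 2 * (Real.pi : ℂ) * I * (n : ℂ) - (t : ℂ) * β}

/-- `G` is the branch, with cuts `2πin + β ℝ_{≤ 0}`, of the function given by `g` for `Re y > 0`:
it is the analytic continuation of `g` to the cut plane, and on the cuts, outside `2πiℤ`, it takes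
the boundary values from the side where `Im (y / β)` increases. This is the side from which the
principal branches of functions of `x_n = (y + 2πin)/β` are continuous (argument `π`). -/
structure IsBranch (β : ℂ) (g G : ℂ → ℂ) : Prop where
  analytic : DifferentiableOn ℂ G (cutPlane β)
  eq_of_re_pos : ∀ y : ℂ, 0 < y.re → G y = g y
  boundary : ∀ y : ℂ, y ∉ periods → ContinuousWithinAt G {w | 0 ≤ ((w - y) / β).im} y

end QPoch

end

/-! The same third-order Euler–Maclaurin formula on `[0, 1]`, with kernel `B₃(t)/6`, is applied to
two functions. For `log (x + t)` it expresses the decrement `f x - f (x + 1)` as `-∫ B₃(t)/6 · 2/(x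
+ t)³ dt` (`stirlingStep_eq_integral`), and Euler's limit with Stirling's formula for `N!` gives `f
x` as the sum of its decrements (`hasSum_stirlingStep`). For `log (1 - e^{-(y + tβ)})`, whose
primitive in `t` is `Li₂/β`, it produces the elementary terms `mainPart`.

The link is the partial fraction expansion `hasSum_inv_cube`: up to the factor `β³`, summing the
kernels `2/(x_n + t)³` over `n` gives the third derivative of `log (1 - e^{-w})` at `w = y + tβ`.
Hence the decrements at all nodes sum to `mainPart y - mainPart (y + β) - log (1 - e^{-y})`
(`hasSum_stirlingStep_node`). Replacing `y` by `y + kβ` and summing over `k` telescopes, because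
`mainPart` tends to `0`; cubic decay makes the sum over `(n, k)` absolutely convergent, so its order
may be exchanged. This is the logarithmic identity `tsum_logBranch`, and its exponential is the
product formula on the cut plane.

Both branches are written down explicitly, using reflection and inversion to the left of the
imaginary axis, and are unique by the identity theorem. Points on the cuts are limits from the
prescribed side: near such a point at most one node meets the negative axis, its factor is
continuous from that side, and the remaining factors converge by domination. -/

noncomputable section

namespace QPoch

open Complex Filter Topology Set MeasureTheory intervalIntegral

/-! ### Third-order Euler–Maclaurin summation on the unit interval. -/

/-- The cubic Euler--Maclaurin kernel `B₃(t) / 6` on `[0, 1]`. -/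
def emKernel (t : ℝ) : ℝ := (t - 3 * t ^ 2 + 2 * t ^ 3) / 12

theorem continuous_emKernel : Continuous emKernel := by
  unfold emKernel; fun_prop

theorem abs_emKernel_le {t : ℝ} (ht : t ∈ Icc (0 : ℝ) 1) : |emKernel t| ≤ 1 / 2 := by
  obtain ⟨h0, h1⟩ := ht
  unfold emKernel
  rw [abs_le]
  have h2 : t ^ 2 ≤ 1 := by nlinarith
  have h3 : t ^ 3 ≤ 1 := by nlinarith [mul_nonneg h0 (sq_nonneg t)]
  have h4 : 0 ≤ t ^ 3 := by positivity
  constructor <;> nlinarith [sq_nonneg t]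

/-- The Euler--Maclaurin formula of order three on `[0, 1]`. -/
theorem integral_emKernel_mul {Φ φ φ₁ φ₂ φ₃ : ℝ → ℂ}
    (h0 : ∀ t ∈ Icc (0 : ℝ) 1, HasDerivAt Φ (φ t) t)
    (h1 : ∀ t ∈ Icc (0 : ℝ) 1, HasDerivAt φ (φ₁ t) t)
    (h2 : ∀ t ∈ Icc (0 : ℝ) 1, HasDerivAt φ₁ (φ₂ t) t)
    (h3 : ∀ t ∈ Icc (0 : ℝ) 1, HasDerivAt φ₂ (φ₃ t) t)
    (hc : ContinuousOn φ₃ (Icc 0 1)) :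
    ∫ t in (0 : ℝ)..1, (emKernel t : ℂ) * φ₃ t =
      -(φ₁ 1 - φ₁ 0) / 12 + (φ 1 + φ 0) / 2 - (Φ 1 - Φ 0) := by
  have hP : ∀ t : ℝ, HasDerivAt (fun t : ℝ => (emKernel t : ℂ))
      ((1 - 6 * (t : ℂ) + 6 * (t : ℂ) ^ 2) / 12) t := by
    intro t
    have : HasDerivAt (fun z : ℂ => (z - 3 * z ^ 2 + 2 * z ^ 3) / 12)
        ((1 - 6 * (t : ℂ) + 6 * (t : ℂ) ^ 2) / 12) (t : ℂ) := by
      have := (((hasDerivAt_id (t : ℂ)).sub ((hasDerivAt_pow 2 (t : ℂ)).const_mul 3)).add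
        ((hasDerivAt_pow 3 (t : ℂ)).const_mul 2)).div_const 12
      refine this.congr_deriv ?_
      norm_num
      ring
    refine this.comp_ofReal.congr_of_eventuallyEq (Eventually.of_forall fun s => ?_)
    simp [emKernel]
  have hP' : ∀ t : ℝ, HasDerivAt (fun t : ℝ => (1 - 6 * (t : ℂ) + 6 * (t : ℂ) ^ 2) / 12)
      ((t : ℂ) - 1 / 2) t := by
    intro t
    have : HasDerivAt (fun z : ℂ => (1 - 6 * z + 6 * z ^ 2) / 12) ((t : ℂ) - 1 / 2) (t : ℂ) := by
      have := ((((hasDerivAt_id (t : ℂ)).const_mul 6).const_sub 1).add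
        ((hasDerivAt_pow 2 (t : ℂ)).const_mul 6)).div_const 12
      refine this.congr_deriv ?_
      norm_num
      ring
    exact this.comp_ofReal
  have hP'' : ∀ t : ℝ, HasDerivAt (fun t : ℝ => (t : ℂ) - 1 / 2) 1 t := fun t =>
    ((hasDerivAt_id (t : ℂ)).sub_const (1 / 2)).comp_ofReal
  -- Three integrations by parts at once. With `P = emKernel`, `P''' = 1`; at both ends `P = 0` and
  -- `P' = 1/12`, while `P''` is `-1/2` at `0` and `1/2` at `1`.
  have key : ∀ t ∈ uIcc (0 : ℝ) 1, HasDerivAt (fun t : ℝ => (emKernel t : ℂ) * φ₂ t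
      - (1 - 6 * (t : ℂ) + 6 * (t : ℂ) ^ 2) / 12 * φ₁ t + ((t : ℂ) - 1 / 2) * φ t - Φ t)
      ((emKernel t : ℂ) * φ₃ t) t := by
    intro t ht
    rw [uIcc_of_le zero_le_one] at ht
    refine (((((hP t).mul (h3 t ht)).sub ((hP' t).mul (h2 t ht))).add
      ((hP'' t).mul (h1 t ht))).sub (h0 t ht)).congr_deriv ?_
    ring
  rw [integral_eq_sub_of_hasDerivAt key]
  · simp [emKernel]; norm_num; ring
  · apply ContinuousOn.intervalIntegrable
    rw [uIcc_of_le zero_le_one]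
    exact (continuous_ofReal.comp continuous_emKernel).continuousOn.mul hc

/-! ### Decrements of the Stirling remainder. -/

theorem add_ofReal_mem_slitPlane {x : ℂ} (hx : x ∈ slitPlane) {t : ℝ} (ht : 0 ≤ t) :
    x + t ∈ slitPlane := by
  rw [mem_slitPlane_iff] at hx ⊢
  rcases hx with h | h
  · left; simp; linarith
  · right; simpa using h

theorem add_natCast_mem_slitPlane {x : ℂ} (hx : x ∈ slitPlane) (k : ℕ) :
    x + k ∈ slitPlane := by
  simpa using add_ofReal_mem_slitPlane hx (Nat.cast_nonneg k)

/-- The decrement `f x - f (x + 1)` of the remainder `f` in Stirling's formula. -/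
def stirlingStep (x : ℂ) : ℂ :=
  (x + 1 / 2) * (log (x + 1) - log x) - 1 + (1 / (x + 1) - 1 / x) / 12

/-- Euler–Maclaurin for the logarithm. The segment from `x` to `x + 1` stays in the slit plane, so
the principal logarithm does not jump along it. -/
theorem stirlingStep_eq_integral {x : ℂ} (hx : x ∈ slitPlane) :
    stirlingStep x = -∫ t in (0 : ℝ)..1, (emKernel t : ℂ) * (2 / (x + t) ^ 3) := by
  have hs : ∀ t ∈ Icc (0 : ℝ) 1, x + (t : ℂ) ∈ slitPlane := fun t ht =>
    add_ofReal_mem_slitPlane hx ht.1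
  have hn : ∀ t ∈ Icc (0 : ℝ) 1, x + (t : ℂ) ≠ 0 := fun t ht => slitPlane_ne_zero (hs t ht)
  have hd : ∀ t : ℝ, HasDerivAt (fun t : ℝ => x + (t : ℂ)) 1 t := fun t =>
    ((hasDerivAt_id (t : ℂ)).const_add x).comp_ofReal
  have hl : ∀ t ∈ Icc (0 : ℝ) 1, HasDerivAt (fun t : ℝ => log (x + t)) (1 / (x + t)) t :=
    fun t ht => (hd t).clog_real (hs t ht)
  rw [integral_emKernel_mul
    (Φ := fun t => (x + t) * log (x + t) - (x + t)) (φ := fun t => log (x + t))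
    (φ₁ := fun t => 1 / (x + t)) (φ₂ := fun t => -1 / (x + t) ^ 2)]
  · have h0 : x ≠ 0 := slitPlane_ne_zero hx
    have h1 : x + 1 ≠ 0 := by simpa using hn 1 (by simp)
    simp only [ofReal_one, ofReal_zero, add_zero, stirlingStep]
    ring
  · intro t ht
    refine (((hd t).mul (hl t ht)).sub (hd t)).congr_deriv ?_
    have := hn t ht
    field_simp; ring
  · exact hl
  · intro t ht
    refine ((hasDerivAt_const t (1 : ℂ)).fun_div (hd t) (hn t ht)).congr_deriv ?_
    simp
  · intro t ht
    refine ((hasDerivAt_const t (-1 : ℂ)).fun_div ((hd t).pow 2)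
      (pow_ne_zero 2 (hn t ht))).congr_deriv ?_
    have := hn t ht
    field_simp
    simp
    ring
  · refine continuousOn_const.div (Continuous.continuousOn (by fun_prop)) fun t ht =>
      pow_ne_zero 3 (hn t ht)

theorem norm_stirlingStep_le {x : ℂ} (hx : x ∈ slitPlane) {a : ℝ} (ha : 0 < a)
    (h : ∀ t ∈ Icc (0 : ℝ) 1, a ≤ ‖x + t‖) : ‖stirlingStep x‖ ≤ 1 / a ^ 3 := by
  rw [stirlingStep_eq_integral hx, norm_neg]
  have := intervalIntegral.norm_integral_le_of_norm_le_const (a := (0 : ℝ)) (b := 1)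
    (f := fun t : ℝ => (emKernel t : ℂ) * (2 / (x + t) ^ 3)) (C := 1 / a ^ 3) ?_
  · simpa using this
  intro t ht
  rw [uIoc_of_le zero_le_one] at ht
  have ht' : t ∈ Icc (0 : ℝ) 1 := ⟨ht.1.le, ht.2⟩
  rw [norm_mul, norm_div, norm_pow, norm_real, Real.norm_eq_abs]
  have h1 := abs_emKernel_le ht'
  have h2 := h t ht'
  calc |emKernel t| * (‖(2 : ℂ)‖ / ‖x + t‖ ^ 3) ≤ 1 / 2 * (2 / a ^ 3) := by
        rw [Complex.norm_ofNat]; gcongr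
    _ = 1 / a ^ 3 := by ring

theorem continuousAt_stirlingStep {x : ℂ} (h0 : x ∈ slitPlane) :
    ContinuousAt stirlingStep x := by
  have h1 : x + 1 ∈ slitPlane := by simpa using add_natCast_mem_slitPlane h0 1
  have := slitPlane_ne_zero h0
  have := slitPlane_ne_zero h1
  unfold stirlingStep
  have hl1 : ContinuousAt (fun x : ℂ => log (x + 1)) x :=
    ContinuousAt.clog (by fun_prop) h1
  have hl0 : ContinuousAt (fun x : ℂ => log x) x := continuousAt_clog h0
  fun_prop (disch := assumption)

/-- Along `x, x + 1, x + 2, …` the distance to the origin grows linearly. -/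
theorem exists_mul_le_norm_add {x : ℂ} (hx : x ∈ slitPlane) :
    ∃ c > 0, ∀ s : ℝ, 0 ≤ s → c * (1 + s) ≤ ‖x + s‖ := by
  obtain ⟨δ, hδ, hb⟩ := Metric.isOpen_iff.1 isOpen_slitPlane x hx
  have h1 : ∀ s : ℝ, 0 ≤ s → δ ≤ ‖x + s‖ := by
    intro s hs
    by_contra! hlt
    have : (-s : ℂ) ∈ slitPlane := hb (by
      rw [Metric.mem_ball, dist_comm, dist_eq]; simpa using hlt)
    rw [mem_slitPlane_iff] at this
    rcases this with h | h <;> simp at h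
    linarith
  -- From `s ≤ ‖x + s‖ + ‖x‖`; the constant `1 + ‖x‖` is absorbed using `δ ≤ ‖x + s‖`.
  refine ⟨1 / (1 + (1 + ‖x‖) / δ), by positivity, fun s hs => ?_⟩
  have h2 : s ≤ ‖x + s‖ + ‖x‖ := by
    have := norm_sub_le (x + s) x
    simp [abs_of_nonneg hs] at this
    exact this
  have h3 := h1 s hs
  have h4 : (1 + ‖x‖) ≤ (1 + ‖x‖) / δ * ‖x + s‖ := by
    rw [div_mul_eq_mul_div, le_div_iff₀ hδ]; gcongr
  rw [one_div_mul_eq_div, div_le_iff₀ (by positivity)]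
  linarith

theorem summable_stirlingStep {x : ℂ} (hx : x ∈ slitPlane) :
    Summable fun k : ℕ => stirlingStep (x + k) := by
  obtain ⟨c, hc, h⟩ := exists_mul_le_norm_add hx
  have hs : Summable fun k : ℕ => 1 / c ^ 3 * (1 / ((k + 1 : ℕ) : ℝ) ^ 3) :=
    ((summable_nat_add_iff 1).2 (Real.summable_one_div_nat_pow.2 (by norm_num : 1 < 3))).mul_left _
  refine Summable.of_norm_bounded hs fun k => ?_
  refine (norm_stirlingStep_le (add_natCast_mem_slitPlane hx k) (a := c * (1 + k))
    (by positivity) fun t ht => ?_).trans_eq ?_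
  · have := h (k + t) (by have := ht.1; positivity)
    push_cast at this
    rw [add_assoc]
    refine le_trans ?_ this
    have := ht.1
    gcongr
    linarith
  · push_cast
    rw [mul_pow]; field_simp; ring

/-! ### Euler's limit for `log Γ` and the remainder as a sum of decrements. -/

/-- The elementary part of Stirling's formula, without the constant. -/
def stirlingMain (x : ℂ) : ℂ := (x - 1 / 2) * log x - x + 1 / (12 * x)

theorem stirlingStep_eq (x : ℂ) :
    stirlingStep x = -log x - stirlingMain x + stirlingMain (x + 1) := by
  unfold stirlingStep stirlingMain
  simp only [one_div, mul_inv]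
  ring

theorem sum_log_add (x : ℂ) (N : ℕ) :
    ∑ j ∈ Finset.range N, log (x + j) =
      stirlingMain (x + N) - stirlingMain x - ∑ j ∈ Finset.range N, stirlingStep (x + j) := by
  induction N with
  | zero => simp
  | succ N ih =>
    rw [Finset.sum_range_succ, ih, Finset.sum_range_succ, stirlingStep_eq]
    push_cast
    rw [← add_assoc]
    ring

theorem tendsto_log_factorial :
    Tendsto (fun N : ℕ => Real.log (N.factorial : ℝ) - ((N + 1 / 2) * Real.log N - N)) atTop
      (𝓝 (Real.log (2 * Real.pi) / 2)) := by
  have h1 := (Real.continuousAt_log (by positivity)).tendsto.comp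
    Stirling.tendsto_stirlingSeq_sqrt_pi
  -- `Stirling.stirlingSeq` has `√(2n)` in its denominator and limit `√π`; restoring the factor `√2`
  -- gives the constant `log (2π) / 2`.
  have h2 : Real.log (2 * Real.pi) / 2 = Real.log √Real.pi + Real.log 2 / 2 := by
    rw [Real.log_mul (by norm_num) Real.pi_ne_zero, Real.log_sqrt Real.pi_pos.le]; ring
  rw [h2]
  refine (h1.add_const (Real.log 2 / 2)).congr' ?_
  filter_upwards [eventually_gt_atTop 0] with N hN
  have hN' : (0 : ℝ) < N := by exact_mod_cast hN
  simp only [Function.comp, Stirling.stirlingSeq]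
  rw [Real.log_div (by positivity) (by positivity), Real.log_mul (by positivity) (by positivity),
    Real.log_sqrt (by positivity), Real.log_mul (by positivity) (by positivity),
    Real.log_pow, Real.log_div (by positivity) (by positivity), Real.log_exp]
  ring

theorem tendsto_log_natCast_add (x : ℂ) :
    Tendsto (fun N : ℕ => (N : ℂ) * (log (x + N) - Real.log N)) atTop (𝓝 x) ∧
    Tendsto (fun N : ℕ => (log (x + N) - Real.log N)) atTop (𝓝 0) := by
  have h1 : Tendsto (fun N : ℕ => (N : ℂ) * log (1 + x / N)) atTop (𝓝 x) := by
    refine tendsto_nat_mul_log_one_add_of_tendsto ?_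
    refine tendsto_const_nhds.congr' ?_
    filter_upwards [eventually_gt_atTop 0] with N hN
    have : (N : ℂ) ≠ 0 := by exact_mod_cast hN.ne'
    field_simp
  have hx : Tendsto (fun N : ℕ => 1 + x / N) atTop (𝓝 1) := by
    simpa using (tendsto_const_div_atTop_nhds_zero_nat x).const_add 1
  have he : ∀ᶠ N : ℕ in atTop, log (1 + x / N) = log (x + N) - Real.log N := by
    filter_upwards [eventually_gt_atTop 0,
      hx.eventually (isOpen_slitPlane.mem_nhds one_mem_slitPlane)] with N hN hs
    have hN' : (0 : ℝ) < N := by exact_mod_cast hN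
    have hc : (N : ℂ) ≠ 0 := by exact_mod_cast hN.ne'
    have : x + N = ((N : ℝ) : ℂ) * (1 + x / N) := by push_cast; field_simp; ring
    rw [this, log_ofReal_mul hN' (slitPlane_ne_zero hs)]
    simp
  refine ⟨h1.congr' ?_, ?_⟩
  · filter_upwards [he] with N hN using by rw [hN]
  · have h2 : Tendsto (fun N : ℕ => log (1 + x / N)) atTop (𝓝 0) := by
      have := (continuousAt_clog one_mem_slitPlane).tendsto.comp hx
      simpa [Function.comp_def] using this
    exact h2.congr' he

theorem tendsto_stirlingMain (x : ℂ) :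
    Tendsto (fun N : ℕ => x * Real.log N + Real.log (N.factorial : ℝ) - stirlingMain (x + N + 1))
      atTop (𝓝 ((Real.log (2 * Real.pi) : ℂ) / 2)) := by
  obtain ⟨h1, h2⟩ := tendsto_log_natCast_add (x + 1)
  have h3 := (continuous_ofReal.tendsto _).comp tendsto_log_factorial
  have h4 : Tendsto (fun N : ℕ => 1 / (12 * (x + 1 + N))) atTop (𝓝 0) := by
    have h5 : Tendsto (fun N : ℕ => x + 1 + (N : ℂ)) atTop (Bornology.cobounded ℂ) := by
      refine (tendsto_const_add_cobounded (x + 1)).comp ?_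
      rw [← tendsto_norm_atTop_iff_cobounded]
      simpa using tendsto_natCast_atTop_atTop
    have := (tendsto_inv₀_cobounded.comp h5).const_mul (1 / 12)
    simp only [mul_zero] at this
    refine this.congr fun N => ?_
    simp
    ring
  have := ((h3.sub h1).sub (h2.const_mul (x + 1 / 2))).sub h4 |>.add_const (x + 1)
  simp only [mul_zero, sub_zero, sub_add_cancel, ofReal_div, ofReal_ofNat] at this
  refine this.congr fun N => ?_
  unfold stirlingMain
  simp only [Function.comp]
  push_cast
  rw [show x + N + 1 = x + 1 + N by ring]
  ring

/-- `log (1 + z) - z` is quadratic in `z`, so the terms are `O(1/n²)`. -/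
theorem summable_logGamma_terms (x : ℂ) :
    Summable fun n : ℕ => x / ((n : ℂ) + 1) - log (1 + x / ((n : ℂ) + 1)) := by
  have hs : Summable fun n : ℕ => ‖x‖ ^ 2 * (1 / ((n + 1 : ℕ) : ℝ) ^ 2) :=
    ((summable_nat_add_iff 1).2 (Real.summable_one_div_nat_pow.2 one_lt_two)).mul_left _
  have hz : Tendsto (fun n : ℕ => ‖x / ((n : ℂ) + 1)‖) atTop (𝓝 0) := by
    have := ((tendsto_const_div_atTop_nhds_zero_nat x).comp (tendsto_add_atTop_nat 1)).norm
    simpa using this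
  refine Summable.of_norm_bounded_eventually_nat hs ?_
  filter_upwards [hz.eventually (gt_mem_nhds (by norm_num : (0 : ℝ) < 1 / 2))] with n hn
  rw [norm_sub_rev]
  refine (norm_log_one_add_sub_self_le (by linarith)).trans ?_
  have h1 : (1 - ‖x / ((n : ℂ) + 1)‖)⁻¹ ≤ 2 := by
    rw [inv_le_comm₀ (by linarith) (by norm_num)]; linarith
  have h2 : ‖x / ((n : ℂ) + 1)‖ ^ 2 = ‖x‖ ^ 2 * (1 / ((n + 1 : ℕ) : ℝ) ^ 2) := by
    rw [norm_div, div_pow]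
    have : ‖(n : ℂ) + 1‖ = ((n + 1 : ℕ) : ℝ) := by
      rw [← Nat.cast_succ, Complex.norm_natCast]
    rw [this]; ring
  rw [← h2]
  have h3 := sq_nonneg ‖x / ((n : ℂ) + 1)‖
  nlinarith

/-- Euler's limit formula for `log Γ`. -/
theorem tendsto_logGamma {x : ℂ} (hx : x ∈ slitPlane) :
    Tendsto (fun N : ℕ => x * Real.log N + Real.log (N.factorial : ℝ)
      - ∑ j ∈ Finset.range (N + 1), log (x + j)) atTop (𝓝 (logGamma x)) := by
  have h1 := ((summable_logGamma_terms x).hasSum.tendsto_sum_nat).const_add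
    (-(Real.eulerMascheroniConstant : ℂ) * x - log x)
  -- Subtracting `x (H_N - log N)`, which tends to `γ x`, turns the Weierstrass partial sums into
  -- Euler's.
  have h2 := ((continuous_ofReal.tendsto _).comp Real.tendsto_harmonic_sub_log).const_mul x
  have h3 := (h1.sub h2).add_const (x * (Real.eulerMascheroniConstant : ℂ))
  rw [sub_add_cancel] at h3
  refine h3.congr fun N => ?_
  have h4 : ∀ n : ℕ, log (1 + x / ((n : ℂ) + 1)) = log (x + (n + 1 : ℕ)) - log ((n + 1 : ℕ) : ℂ) := by
    intro n
    have hp : (0 : ℝ) < ((n + 1 : ℕ) : ℝ) := by positivity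
    have hc : ((n : ℂ) + 1) ≠ 0 := by exact_mod_cast Nat.succ_ne_zero n
    have he : x + (n + 1 : ℕ) = (((n + 1 : ℕ) : ℝ) : ℂ) * (1 + x / ((n : ℂ) + 1)) := by
      push_cast; field_simp; ring
    have hne : 1 + x / ((n : ℂ) + 1) ≠ 0 := by
      intro h0
      rw [h0, mul_zero] at he
      exact slitPlane_ne_zero (add_natCast_mem_slitPlane hx (n + 1)) he
    rw [he, log_ofReal_mul hp hne, ofReal_log hp.le]
    push_cast; ring
  have h5 : (Real.log (N.factorial : ℝ) : ℂ) = ∑ n ∈ Finset.range N, log ((n + 1 : ℕ) : ℂ) := by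
    rw [← Finset.prod_range_add_one_eq_factorial, Nat.cast_prod, Real.log_prod]
    · rw [ofReal_sum]
      refine Finset.sum_congr rfl fun n _ => ?_
      rw [ofReal_log (by positivity)]
      push_cast; rfl
    · intro n _; positivity
  have h6 : ((harmonic N : ℝ) : ℂ) = ∑ n ∈ Finset.range N, 1 / ((n : ℂ) + 1) := by
    simp [harmonic]
  simp only [Function.comp]
  rw [Finset.sum_sub_distrib, Finset.sum_range_succ', h5, ofReal_sub, h6]
  simp_rw [h4, Finset.sum_sub_distrib, div_eq_mul_one_div x ((_ : ℂ) + 1), ← Finset.mul_sum]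
  simp
  ring

/-- Partial sums of the decrements telescope by `sum_log_add`; subtracting the limit of
`tendsto_stirlingMain` from Euler's limit leaves exactly the remainder. The shift by one matches the
`N + 1` factors in Euler's product. -/
theorem hasSum_stirlingStep {x : ℂ} (hx : x ∈ slitPlane) :
    HasSum (fun k : ℕ => stirlingStep (x + k)) (stirlingRemainder x) := by
  rw [(summable_stirlingStep hx).hasSum_iff_tendsto_nat, ← tendsto_add_atTop_iff_nat 1]
  have := ((tendsto_logGamma hx).sub (tendsto_stirlingMain x)).sub_const (stirlingMain x)
  have e : logGamma x - (Real.log (2 * Real.pi) : ℂ) / 2 - stirlingMain x =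
      stirlingRemainder x := by
    unfold stirlingRemainder stirlingMain; ring
  rw [e] at this
  refine this.congr fun N => ?_
  rw [sum_log_add]
  push_cast
  rw [← add_assoc]
  ring

theorem exp_logGamma {x : ℂ} (hx : x ∈ slitPlane) : exp (logGamma x) = Gamma x := by
  refine tendsto_nhds_unique ((continuous_exp.tendsto _).comp (tendsto_logGamma hx))
    ((GammaSeq_tendsto_Gamma x).congr' ?_)
  filter_upwards [eventually_gt_atTop 0] with N hN
  have hN' : (0 : ℝ) < N := by exact_mod_cast hN
  have hf : (0 : ℝ) < N.factorial := by positivity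
  simp only [Function.comp]
  rw [exp_sub, exp_add, exp_sum, GammaSeq, ofReal_log hf.le, exp_log (by exact_mod_cast hf.ne'),
    cpow_def_of_ne_zero (by exact_mod_cast hN.ne'), ofReal_log hN'.le, mul_comm x]
  congr 1
  refine Finset.prod_congr rfl fun j _ => ?_
  rw [exp_log (slitPlane_ne_zero (add_natCast_mem_slitPlane hx j))]

theorem dressedInvGamma_eq_exp {x : ℂ} (hx : x ∈ slitPlane) :
    dressedInvGamma x = exp (-stirlingRemainder x) := by
  have h0 := slitPlane_ne_zero hx
  have h2 : (Real.sqrt (2 * Real.pi) : ℂ) = exp ((Real.log (2 * Real.pi) : ℂ) / 2) := by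
    rw [Real.sqrt_eq_rpow, Real.rpow_def_of_pos (by positivity), ofReal_exp]
    push_cast; ring_nf
  unfold dressedInvGamma stirlingRemainder
  rw [← exp_logGamma hx, h2, cpow_def_of_ne_zero h0, ← exp_sub, ← exp_add, ← exp_add]
  congr 1; ring

/-! ### Geometry of the cut plane and lower bounds on the half-lattice. -/

/-- The coordinate `u` in `y = 2πi u + s β` with real `u` and `s`. -/
def latticeCoord (β y : ℂ) : ℝ := (y.im - y.re * β.im / β.re) / (2 * Real.pi)

theorem continuous_latticeCoord (β : ℂ) : Continuous (latticeCoord β) := by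
  unfold latticeCoord; fun_prop

theorem eq_latticeCoord {β : ℂ} (hβ : 0 < β.re) (y : ℂ) :
    y = 2 * (Real.pi : ℂ) * I * (latticeCoord β y : ℂ) + ((y.re / β.re : ℝ) : ℂ) * β := by
  have hu : 2 * Real.pi * latticeCoord β y = y.im - y.re * β.im / β.re := by
    have := Real.pi_pos
    unfold latticeCoord; field_simp
  apply Complex.ext
  · simp; field_simp
  · simp [hu]; field_simp; ring

/-- In the oblique coordinates of `eq_latticeCoord` the cuts are the integer levels over `Re y ≤ 0`,
so the floor of `latticeCoord` labels the strips between them. -/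
theorem mem_cutPlane_iff {β : ℂ} (hβ : 0 < β.re) {y : ℂ} :
    y ∈ cutPlane β ↔ ¬ (latticeCoord β y ∈ range ((↑) : ℤ → ℝ) ∧ y.re ≤ 0) := by
  have hpi := Real.pi_pos
  constructor
  · rintro h ⟨⟨n, hn⟩, hy⟩
    refine h n (-(y.re / β.re)) (by rw [neg_nonneg]; exact div_nonpos_of_nonpos_of_nonneg hy hβ.le) ?_
    conv_lhs => rw [eq_latticeCoord hβ y, ← hn]
    push_cast; ring
  · rintro h n t ht rfl
    apply h
    refine ⟨⟨n, ?_⟩, ?_⟩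
    · unfold latticeCoord; simp; field_simp; ring
    · simp; positivity

theorem mem_periods_iff {β : ℂ} (hβ : 0 < β.re) {y : ℂ} :
    y ∈ periods ↔ latticeCoord β y ∈ range ((↑) : ℤ → ℝ) ∧ y.re = 0 := by
  have hpi := Real.pi_pos
  constructor
  · rintro ⟨n, rfl⟩
    refine ⟨⟨n, ?_⟩, by simp⟩
    unfold latticeCoord; simp
  · rintro ⟨⟨n, hn⟩, hy⟩
    refine ⟨n, ?_⟩
    rw [eq_latticeCoord hβ y, ← hn, hy]
    simp

theorem isOpen_cutPlane {β : ℂ} (hβ : 0 < β.re) : IsOpen (cutPlane β) := by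
  have : cutPlane β = (latticeCoord β ⁻¹' range ((↑) : ℤ → ℝ) ∩ {y | y.re ≤ 0})ᶜ := by
    ext y; rw [mem_cutPlane_iff hβ]; rfl
  rw [this, isOpen_compl_iff]
  exact (Int.isClosedEmbedding_coe_real.isClosed_range.preimage (continuous_latticeCoord β)).inter
    (isClosed_le continuous_re continuous_const)

theorem mem_slitPlane_of_forall {x : ℂ} (h : ∀ s : ℝ, 0 ≤ s → x + s ≠ 0) : x ∈ slitPlane := by
  by_contra hx
  rw [mem_slitPlane_iff, not_or, not_lt, not_not] at hx
  refine h (-x.re) (by linarith [hx.1]) ?_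
  apply Complex.ext <;> simp [hx.2]

theorem node_add {β : ℂ} (hβ : β ≠ 0) (y : ℂ) (n : ℤ) (s : ℂ) :
    node β y n + s = (y + 2 * (Real.pi : ℂ) * I * (n : ℂ) + s * β) / β := by
  unfold node; field_simp

theorem node_mem_slitPlane {β : ℂ} (hβ : β ≠ 0) {y : ℂ} (hy : y ∈ cutPlane β) (n : ℤ) :
    node β y n ∈ slitPlane := by
  refine mem_slitPlane_of_forall fun s hs h => hy (-n) s hs ?_
  rw [node_add hβ, div_eq_zero_iff, or_iff_left hβ] at h
  push_cast
  linear_combination h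

theorem add_mem_cutPlane {β y : ℂ} (hy : y ∈ cutPlane β) {t : ℝ} (ht : 0 ≤ t) :
    y + t * β ∈ cutPlane β := fun n s hs h =>
  hy n (s + t) (by positivity) (by push_cast; linear_combination h)

theorem mem_cutPlane_of_re_pos {β y : ℂ} (hβ : 0 < β.re) (hy : 0 < y.re) : y ∈ cutPlane β := by
  rw [mem_cutPlane_iff hβ]
  rintro ⟨-, h⟩
  linarith

theorem notMem_periods_of_mem_cutPlane (β : ℂ) {y : ℂ} (hy : y ∈ cutPlane β) : y ∉ periods := by
  rintro ⟨n, hn⟩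
  exact hy n 0 le_rfl (by simp [hn])

/-- Points of the half-lattice `2πin + sβ`, translated by `w` in a bounded set, that avoid a disc
around the origin are at least proportional to `1 + |n| + s` in size. -/
theorem exists_mul_le_norm_lattice {β : ℂ} (hβ : 0 < β.re) {δ K : ℝ} (hδ : 0 < δ) (hK : 0 ≤ K) :
    ∃ c > 0, ∀ w : ℂ, ‖w‖ ≤ K → ∀ (n : ℤ) (s : ℝ), 0 ≤ s →
      δ ≤ ‖w + 2 * (Real.pi : ℂ) * I * (n : ℂ) + s * β‖ →
      c * (1 + |(n : ℝ)| + s) ≤ ‖w + 2 * (Real.pi : ℂ) * I * (n : ℂ) + s * β‖ := by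
  -- Real parts bound `s`, imaginary parts then bound `|n|`, and together `|n| + s ≤ M (‖v‖ + K)`.
  -- The bound `δ ≤ ‖v‖` absorbs the constant `1 + M K`.
  set M : ℝ := 1 + (|β.im| + 1) / β.re with hM
  have hM0 : 0 < M := by positivity
  refine ⟨1 / (M + (1 + M * K) / δ), by positivity, fun w hw n s hs hv => ?_⟩
  set v := w + 2 * (Real.pi : ℂ) * I * (n : ℂ) + s * β with hvdef
  have hre : v.re = w.re + s * β.re := by simp [hvdef]
  have him : v.im = w.im + 2 * Real.pi * n + s * β.im := by simp [hvdef]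
  have h1 : s ≤ (‖v‖ + K) / β.re := by
    rw [le_div_iff₀ hβ]
    have := abs_re_le_norm v; have := abs_re_le_norm w
    have := le_abs_self v.re; have := neg_abs_le w.re
    linarith
  have h2 : |(n : ℝ)| ≤ ‖v‖ + K + s * |β.im| := by
    have e : 2 * Real.pi * (n : ℝ) = v.im - w.im - s * β.im := by rw [him]; ring
    have h3 : |2 * Real.pi * (n : ℝ)| ≤ ‖v‖ + K + s * |β.im| := by
      rw [e]
      refine (abs_sub _ _).trans ?_
      rw [abs_mul, abs_of_nonneg hs]
      have := abs_sub v.im w.im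
      have := abs_im_le_norm v; have := abs_im_le_norm w
      linarith
    rw [abs_mul, abs_of_pos Real.two_pi_pos] at h3
    have := abs_nonneg (n : ℝ)
    nlinarith [Real.two_le_pi]
  have h3 : |(n : ℝ)| + s ≤ M * (‖v‖ + K) := by
    have : s * (|β.im| + 1) ≤ (‖v‖ + K) / β.re * (|β.im| + 1) := by gcongr
    have e : M * (‖v‖ + K) = (‖v‖ + K) + (‖v‖ + K) / β.re * (|β.im| + 1) := by rw [hM]; ring
    rw [e]; linarith
  have h4 : 1 + M * K ≤ (1 + M * K) / δ * ‖v‖ := by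
    rw [div_mul_eq_mul_div, le_div_iff₀ hδ]; gcongr
  rw [one_div_mul_eq_div, div_le_iff₀ (by positivity)]
  linarith

/-- The vector is the difference of `y` and the cut point `-2πin - sβ`; since the cut plane is open,
its length has a positive lower bound. -/
theorem exists_mul_le_norm_of_mem_cutPlane {β y : ℂ} (hβ : 0 < β.re) (hy : y ∈ cutPlane β) :
    ∃ c > 0, ∀ (n : ℤ) (s : ℝ), 0 ≤ s →
      c * (1 + |(n : ℝ)| + s) ≤ ‖y + 2 * (Real.pi : ℂ) * I * (n : ℂ) + s * β‖ := by
  obtain ⟨δ, hδ, hb⟩ := Metric.isOpen_iff.1 (isOpen_cutPlane hβ) y hy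
  obtain ⟨c, hc, h⟩ := exists_mul_le_norm_lattice hβ hδ (norm_nonneg y)
  refine ⟨c, hc, fun n s hs => h y le_rfl n s hs ?_⟩
  by_contra! hlt
  have hm : 2 * (Real.pi : ℂ) * I * ((-n : ℤ) : ℂ) - s * β ∈ cutPlane β := by
    apply hb
    rw [Metric.mem_ball, dist_comm, dist_eq]
    convert! hlt using 2
    push_cast; ring
  exact hm (-n) s hs rfl

/-- Near any point outside `2πiℤ` at most one of the half-lines `2πin + β ℝ_{≥ 0}` matters. -/
theorem exists_mul_le_norm_of_ne (β : ℂ) (hβ : 0 < β.re) (y₀ : ℂ) :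
    ∃ m : ℤ, ∃ c > 0, ∀ᶠ w in 𝓝 y₀, ∀ n : ℤ, n ≠ m → ∀ s : ℝ, 0 ≤ s →
      c * (1 + |(n : ℝ)| + s) ≤ ‖w + 2 * (Real.pi : ℂ) * I * (n : ℂ) + s * β‖ := by
  have hpi := Real.pi_pos
  set κ : ℝ := (1 + |β.im| / β.re) / (2 * Real.pi) with hκ
  have hκ0 : 0 < κ := by positivity
  obtain ⟨c, hc, h⟩ := exists_mul_le_norm_lattice hβ (δ := 1 / 4 / κ) (K := ‖y₀‖ + 1)
    (by positivity) (by positivity)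
  -- For `n` different from this index, the lattice coordinate of the translate of `w` is at least
  -- `1 - 1/2 - 1/4 = 1/4` in absolute value: rounding costs `1/2` and moving from `y₀` to `w` costs
  -- `1/4`.
  refine ⟨-round (latticeCoord β y₀), c, hc, ?_⟩
  filter_upwards [Metric.ball_mem_nhds y₀ one_pos,
    (continuous_latticeCoord β).continuousAt (Metric.ball_mem_nhds (latticeCoord β y₀)
      (by norm_num : (0 : ℝ) < 1 / 4))] with w hw1 hw2 n hn s hs
  refine h w ?_ n s hs ?_
  · have := norm_sub_norm_le w y₀
    rw [Metric.mem_ball, dist_eq] at hw1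
    linarith
  set v := w + 2 * (Real.pi : ℂ) * I * (n : ℂ) + s * β with hvdef
  have hu : latticeCoord β v = latticeCoord β w + n := by
    rw [hvdef]
    unfold latticeCoord; simp; field_simp; ring
  have h1 : |latticeCoord β v| ≤ κ * ‖v‖ := by
    unfold latticeCoord
    rw [abs_div, abs_of_pos Real.two_pi_pos, hκ, div_mul_eq_mul_div]
    gcongr
    refine (abs_sub _ _).trans ?_
    rw [abs_div, abs_mul, abs_of_pos hβ]
    have h2 := abs_re_le_norm v; have h3 := abs_im_le_norm v
    have : |v.re| * |β.im| / β.re ≤ ‖v‖ * |β.im| / β.re := by gcongr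
    calc _ ≤ ‖v‖ + ‖v‖ * |β.im| / β.re := add_le_add h3 this
      _ = _ := by ring
  have h2 : 1 / 4 ≤ |latticeCoord β v| := by
    rw [hu]
    rw [mem_preimage, Metric.mem_ball, Real.dist_eq] at hw2
    have h3 := abs_sub_round (latticeCoord β y₀)
    have h4 : (1 : ℝ) ≤ |(round (latticeCoord β y₀) : ℝ) + n| := by
      have : round (latticeCoord β y₀) + n ≠ 0 := by intro h0; exact hn (by omega)
      exact_mod_cast Int.one_le_abs this
    have e : (round (latticeCoord β y₀) : ℝ) + n = (latticeCoord β w + n) -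
        (latticeCoord β w - latticeCoord β y₀) -
          (latticeCoord β y₀ - round (latticeCoord β y₀)) := by ring
    rw [e] at h4
    have h5 := abs_sub (latticeCoord β w + n - (latticeCoord β w - latticeCoord β y₀))
      (latticeCoord β y₀ - round (latticeCoord β y₀))
    have h6 := abs_sub (latticeCoord β w + n) (latticeCoord β w - latticeCoord β y₀)
    linarith
  rw [div_le_iff₀ hκ0]
  linarith

section Bounds

variable {β y : ℂ} {c : ℝ} {n : ℤ}

theorem node_mem_slitPlane_of_bound (hβ : β ≠ 0) (hc : 0 < c) (hb : ∀ s : ℝ, 0 ≤ s →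
      c * (1 + |(n : ℝ)| + s) ≤ ‖y + 2 * (Real.pi : ℂ) * I * (n : ℂ) + s * β‖) :
    node β y n ∈ slitPlane := by
  refine mem_slitPlane_of_forall fun s hs h => ?_
  rw [node_add hβ, div_eq_zero_iff, or_iff_left hβ] at h
  have := hb s hs
  rw [h, norm_zero] at this
  have : 0 < c * (1 + |(n : ℝ)| + s) := by positivity
  linarith

theorem norm_stirlingStep_node_le (hβ : β ≠ 0) (hc : 0 < c) (hb : ∀ s : ℝ, 0 ≤ s →
      c * (1 + |(n : ℝ)| + s) ≤ ‖y + 2 * (Real.pi : ℂ) * I * (n : ℂ) + s * β‖) (k : ℕ) :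
    ‖stirlingStep (node β y n + k)‖ ≤ (‖β‖ / c) ^ 3 * (1 / (1 + |(n : ℝ)| + k) ^ 3) := by
  have hβ' : 0 < ‖β‖ := norm_pos_iff.2 hβ
  refine (norm_stirlingStep_le (add_natCast_mem_slitPlane (node_mem_slitPlane_of_bound hβ hc hb) k)
    (a := c * (1 + |(n : ℝ)| + k) / ‖β‖) (by positivity) fun t ht => ?_).trans_eq ?_
  · have h1 := hb (k + t) (by have := ht.1; positivity)
    push_cast at h1
    rw [add_assoc (node β y n), node_add hβ, norm_div]
    gcongr
    refine le_trans ?_ h1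
    have := ht.1
    gcongr
    linarith
  · field_simp

end Bounds

/-! ### Summability over the half-lattice. -/

theorem summable_one_div_one_add_abs_rpow :
    Summable fun n : ℤ => 1 / (1 + |(n : ℝ)|) ^ (3 / 2 : ℝ) := by
  have h : Summable fun n : ℕ => 1 / (1 + (n : ℝ)) ^ (3 / 2 : ℝ) := by
    have := (summable_nat_add_iff 1).2
      (Real.summable_one_div_nat_rpow.2 (by norm_num : (1 : ℝ) < 3 / 2))
    refine this.congr fun n => ?_
    push_cast
    rw [add_comm]
  refine summable_int_iff_summable_nat_and_neg.2 ⟨?_, ?_⟩ <;> simpa using h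

/-- From `(1 + a)(1 + b) ≤ (1 + a + b)²`. The cube splits into two powers with exponent `3/2 > 1`,
so the double series is dominated by a product of convergent ones. -/
theorem one_div_pow_three_le {a b : ℝ} (ha : 0 ≤ a) (hb : 0 ≤ b) :
    1 / (1 + a + b) ^ 3 ≤ 1 / (1 + a) ^ (3 / 2 : ℝ) * (1 / (1 + b) ^ (3 / 2 : ℝ)) := by
  rw [one_div_mul_one_div, ← Real.mul_rpow (by positivity) (by positivity)]
  have : (1 + a + b) ^ 3 = ((1 + a + b) ^ 2) ^ (3 / 2 : ℝ) := by
    rw [← Real.rpow_natCast_mul (by positivity), ← Real.rpow_natCast]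
    norm_num
  rw [this]
  gcongr
  nlinarith [mul_nonneg ha hb]

theorem summable_lattice :
    Summable fun p : ℤ × ℕ => 1 / (1 + |(p.1 : ℝ)| + p.2) ^ 3 := by
  have h : Summable fun n : ℕ => 1 / (1 + (n : ℝ)) ^ (3 / 2 : ℝ) := by
    have := (summable_int_iff_summable_nat_and_neg.1 summable_one_div_one_add_abs_rpow).1
    simpa using this
  refine Summable.of_nonneg_of_le (fun p => by positivity)
    (fun p => one_div_pow_three_le (abs_nonneg _) (Nat.cast_nonneg _))
    (summable_one_div_one_add_abs_rpow.mul_of_nonneg h (fun n => ?_) fun n => ?_)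
  · exact one_div_nonneg.2 (by positivity)
  · exact one_div_nonneg.2 (by positivity)

theorem summable_one_div_one_add_abs_pow :
    Summable fun n : ℤ => 1 / (1 + |(n : ℝ)|) ^ 3 := by
  have := summable_lattice.comp_injective (i := fun n : ℤ => (n, 0))
    (fun a b h => by simpa using h)
  simpa [Function.comp_def] using this

/-! ### The partial fraction expansion of the third derivative of `log (1 - e^{-y})`. -/

/-- Uses `n² = 2 C(n+2, 2) - 3 C(n+1, 1) + 1`. -/
theorem tsum_sq_mul_geometric {r : ℂ} (hr : ‖r‖ < 1) :
    ∑' n : ℕ, (n : ℂ) ^ 2 * r ^ n = r * (1 + r) / (1 - r) ^ 3 := by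
  have h2 := (hasSum_choose_mul_geometric_of_norm_lt_one 2 hr).mul_left 2
  have h1 := (hasSum_choose_mul_geometric_of_norm_lt_one 1 hr).mul_left 3
  have h0 := hasSum_geometric_of_norm_lt_one hr
  have hne : (1 - r) ≠ 0 := by
    intro h
    rw [sub_eq_zero] at h
    rw [← h] at hr; simp at hr
  have := ((h2.sub h1).add h0).tsum_eq
  rw [show r * (1 + r) / (1 - r) ^ 3 = 2 * (1 / (1 - r) ^ (2 + 1)) - 3 * (1 / (1 - r) ^ (1 + 1)) +
    (1 - r)⁻¹ by field_simp; ring, ← this]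
  refine tsum_congr fun n => ?_
  have : ((n + 2).choose 2 : ℂ) = (n + 2) * (n + 1) / 2 := by
    rw [Nat.cast_choose_two]; push_cast; ring
  rw [this, Nat.choose_one_right]
  push_cast
  ring

theorem hasSum_inv_cube_of_re_pos {y : ℂ} (hy : 0 < y.re) :
    HasSum (fun n : ℤ => 2 / (y + 2 * (Real.pi : ℂ) * I * (n : ℂ)) ^ 3)
      (exp (-y) * (1 + exp (-y)) / (1 - exp (-y)) ^ 3) := by
  have hpi := Real.pi_pos
  have hpi' : (Real.pi : ℂ) ≠ 0 := by exact_mod_cast hpi.ne'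
  have hn : ∀ n : ℤ, y + 2 * (Real.pi : ℂ) * I * (n : ℂ) ≠ 0 := by
    intro n h
    have := congrArg re h
    simp at this
    linarith
  have hs : Summable fun n : ℤ => 2 / (y + 2 * (Real.pi : ℂ) * I * (n : ℂ)) ^ 3 := by
    obtain ⟨c, hc, h⟩ := exists_mul_le_norm_of_mem_cutPlane (β := 1) (y := y) (by simp)
      (mem_cutPlane_of_re_pos (by simp) hy)
    refine Summable.of_norm_bounded (summable_one_div_one_add_abs_pow.mul_left (2 / c ^ 3))
      fun n => ?_
    have h1 := h n 0 le_rfl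
    simp only [add_zero, ofReal_zero, zero_mul] at h1
    rw [norm_div, norm_pow, Complex.norm_ofNat]
    calc _ ≤ 2 / (c * (1 + |(n : ℝ)|)) ^ 3 := by gcongr
      _ = _ := by field_simp
  rw [hs.hasSum_iff]
  have hz : 0 < (I * y / (2 * Real.pi)).im := by
    have : I * y / (2 * Real.pi) = ((1 / (2 * Real.pi) : ℝ) : ℂ) * (I * y) := by push_cast; ring
    rw [this, im_ofReal_mul]
    simp; positivity
  -- Lipschitz's formula with exponent `k + 1 = 3` at `τ = iy/(2π)`, for which `q = e^{-y}`. The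
  -- nodes appear with `n` replaced by `-n`.
  have key := EisensteinSeries.qExpansion_identity (k := 2) (by norm_num) ⟨_, hz⟩
  have hexp : exp (2 * Real.pi * I * (I * y / (2 * Real.pi))) = exp (-y) := by
    congr 1
    field_simp
    rw [I_sq]; ring
  simp only at key
  rw [hexp, tsum_sq_mul_geometric (by rw [norm_exp]; simpa using hy)] at key
  have h1 : ∀ n : ℤ, 1 / (I * y / (2 * Real.pi) + n) ^ (2 + 1) =
      (-2 * Real.pi * I) ^ (2 + 1) / (2).factorial *
        (2 / (y + 2 * (Real.pi : ℂ) * I * ((-n : ℤ) : ℂ)) ^ 3) := by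
    intro n
    have e : I * y / (2 * Real.pi) + n =
        I / (2 * Real.pi) * (y + 2 * (Real.pi : ℂ) * I * ((-n : ℤ) : ℂ)) := by
      push_cast
      field_simp
      linear_combination (2 * (Real.pi : ℂ) * n) * I_sq
    have := hn (-n)
    rw [e, mul_pow]
    have hI := I_ne_zero
    have hI6 : I ^ 6 = -1 := by rw [show (6 : ℕ) = 2 * 3 by rfl, pow_mul, I_sq]; norm_num
    generalize (y + 2 * (Real.pi : ℂ) * I * ((-n : ℤ) : ℂ)) = v at *
    simp
    field_simp
    linear_combination hI6
  simp_rw [h1] at key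
  rw [tsum_mul_left] at key
  have hne : ((-2 * Real.pi * I : ℂ) ^ (2 + 1) / (2).factorial) ≠ 0 := by
    have := I_ne_zero
    simp [hpi']
  have := mul_left_cancel₀ hne key
  rw [← this]
  exact ((Equiv.neg ℤ).tsum_eq
    (fun n : ℤ => 2 / (y + 2 * (Real.pi : ℂ) * I * (n : ℂ)) ^ 3)).symm

/-- Both sides are odd in `y`. Leaving out the imaginary axis is harmless, as the sum is only used
under an integral. -/
theorem hasSum_inv_cube {y : ℂ} (hy : y.re ≠ 0) :
    HasSum (fun n : ℤ => 2 / (y + 2 * (Real.pi : ℂ) * I * (n : ℂ)) ^ 3)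
      (exp (-y) * (1 + exp (-y)) / (1 - exp (-y)) ^ 3) := by
  rcases hy.lt_or_gt with h | h
  · have h1 := (hasSum_inv_cube_of_re_pos (y := -y) (by simpa using h)).neg
    rw [← (Equiv.neg ℤ).hasSum_iff] at h1
    convert! h1 using 1
    · ext n
      simp only [Function.comp, Equiv.neg_apply]
      push_cast
      rw [← div_neg, show -y + 2 * (Real.pi : ℂ) * I * -(n : ℂ) =
        -(y + 2 * (Real.pi : ℂ) * I * (n : ℂ)) by ring]
      congr 1; ring
    · have hne : exp y ≠ 0 := exp_ne_zero y
      have hne1 : 1 - exp y ≠ 0 := by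
        intro h0
        have : ‖exp y‖ = 1 := by rw [← sub_eq_zero.1 h0]; simp
        rw [norm_exp, Real.exp_eq_one_iff] at this
        exact hy this
      have hne2 : exp y - 1 ≠ 0 := by rw [← neg_ne_zero]; simpa using hne1
      rw [neg_neg, exp_neg]
      field_simp
      ring
  · exact hasSum_inv_cube_of_re_pos h

/-! ### The principal dilogarithm. -/

/-- Near `0` the quotient is bounded by `3/2 ‖z‖`. Elsewhere the imaginary part of the logarithm is
bounded, and `log ‖1 - s z‖` is integrable even across a zero of `1 - s z`. -/
theorem intervalIntegrable_log_one_sub_div (z : ℂ) {r : ℝ} (hr : 0 ≤ r) :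
    IntervalIntegrable (fun s : ℝ => log (1 - (s : ℂ) * z) / (s : ℂ)) volume 0 r := by
  have hmeas : Measurable fun s : ℝ => log (1 - (s : ℂ) * z) / (s : ℂ) := by fun_prop
  set ε : ℝ := 1 / (2 * (1 + ‖z‖)) with hε
  have hε0 : 0 < ε := by positivity
  have hεz : ε * ‖z‖ ≤ 1 / 2 := by
    rw [hε, one_div_mul_eq_div, div_le_div_iff₀ (by positivity) (by positivity)]; linarith
  have h1 : IntervalIntegrable (fun s : ℝ => log (1 - (s : ℂ) * z) / (s : ℂ)) volume 0 ε := by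
    refine (intervalIntegrable_const (c := 3 / 2 * ‖z‖) (μ := volume) (a := 0) (b := ε)).mono_fun
      hmeas.aestronglyMeasurable ?_
    rw [EventuallyLE, ae_restrict_iff' measurableSet_uIoc]
    refine Eventually.of_forall fun s hs => ?_
    rw [uIoc_of_le hε0.le] at hs
    have hsz : ‖-((s : ℂ) * z)‖ ≤ 1 / 2 := by
      rw [norm_neg, norm_mul, norm_real, Real.norm_of_nonneg hs.1.le]
      exact (mul_le_mul_of_nonneg_right hs.2 (norm_nonneg z)).trans hεz
    have := norm_log_one_add_half_le_self hsz
    rw [norm_div, norm_real, Real.norm_of_nonneg hs.1.le, div_le_iff₀ hs.1, sub_eq_add_neg,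
      Real.norm_of_nonneg (by positivity)]
    refine this.trans_eq ?_
    rw [norm_neg, norm_mul, norm_real, Real.norm_of_nonneg hs.1.le]; ring
  have hlog : ∀ a b : ℝ, IntervalIntegrable (fun s : ℝ => log (1 - (s : ℂ) * z)) volume a b := by
    intro a b
    have hre : IntervalIntegrable (fun s : ℝ => Real.log ‖1 - (s : ℂ) * z‖) volume a b := by
      apply MeromorphicOn.intervalIntegrable_log_norm
      intro s _
      have hs : AnalyticAt ℝ (fun s : ℝ => (s : ℂ)) s := ofRealCLM.analyticAt s
      exact (analyticAt_const.sub (hs.mul analyticAt_const)).meromorphicAt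
    have him : IntervalIntegrable (fun s : ℝ => arg (1 - (s : ℂ) * z)) volume a b := by
      refine (intervalIntegrable_const (c := Real.pi) (μ := volume) (a := a) (b := b)).mono_fun
        (Measurable.aestronglyMeasurable (by fun_prop)) (Eventually.of_forall fun s => ?_)
      simpa [abs_of_pos Real.pi_pos] using abs_arg_le_pi _
    have hre' : IntervalIntegrable (fun s : ℝ => (Real.log ‖1 - (s : ℂ) * z‖ : ℂ)) volume a b :=
      ⟨hre.1.ofReal, hre.2.ofReal⟩
    have him' : IntervalIntegrable (fun s : ℝ => (arg (1 - (s : ℂ) * z) : ℂ)) volume a b :=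
      ⟨him.1.ofReal, him.2.ofReal⟩
    exact hre'.add (him'.mul_const I)
  rcases le_total r ε with h | h
  · exact h1.mono_set (by rw [uIcc_of_le hr, uIcc_of_le hε0.le]; exact Icc_subset_Icc_right h)
  · refine h1.trans ?_
    simp_rw [div_eq_mul_inv]
    refine (hlog ε r).mul_continuousOn ?_
    refine ContinuousOn.inv₀ (by fun_prop) fun s hs => ?_
    rw [uIcc_of_le h] at hs
    exact_mod_cast (hε0.trans_le hs.1).ne'

theorem dilog_zero : dilog 0 = 0 := by simp [dilog]

/-- Along a ray from the origin the dilogarithm is the primitive of `-log (1 - s z) / s`. -/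
theorem dilog_ofReal_mul (z : ℂ) (r : ℝ) :
    dilog (r * z) = -∫ s in (0 : ℝ)..r, log (1 - (s : ℂ) * z) / (s : ℂ) := by
  rcases eq_or_ne r 0 with rfl | hr
  · simp [dilog_zero]
  have h := intervalIntegral.integral_comp_mul_left (a := 0) (b := 1)
    (fun s : ℝ => log (1 - (s : ℂ) * z) / (s : ℂ)) hr
  rw [mul_zero, mul_one] at h
  have h' : ∫ s in (0 : ℝ)..r, log (1 - (s : ℂ) * z) / (s : ℂ) =
      r • ∫ t in (0 : ℝ)..1, log (1 - ((r * t : ℝ) : ℂ) * z) / ((r * t : ℝ) : ℂ) := by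
    rw [h, smul_smul, mul_inv_cancel₀ hr, one_smul]
  rw [h', dilog, ← intervalIntegral.integral_smul]
  congr 1
  refine intervalIntegral.integral_congr fun t _ => ?_
  have hr' : (r : ℂ) ≠ 0 := by exact_mod_cast hr
  simp only [real_smul]
  push_cast
  rcases eq_or_ne (t : ℂ) 0 with ht | ht
  · simp [ht]
  · rw [show (t : ℂ) * (r * z) = r * t * z by ring]
    field_simp

/-- If `1 - r z` is negative real, then `z` is real and the whole ray stays on the real axis, where
the principal logarithm has no jump. Derivatives along rays therefore exist on the cut of `dilog`
too. -/
theorem continuousAt_log_one_sub_ofReal_mul {z : ℂ} {r : ℝ} (hr : 0 < r)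
    (h : 1 - (r : ℂ) * z ≠ 0) : ContinuousAt (fun s : ℝ => log (1 - (s : ℂ) * z)) r := by
  have hc : Continuous fun s : ℝ => 1 - (s : ℂ) * z := by fun_prop
  by_cases hs : 1 - (r : ℂ) * z ∈ slitPlane
  · exact hc.continuousAt.clog hs
  rw [mem_slitPlane_iff, not_or, not_lt, not_not] at hs
  have hz : z.im = 0 := by
    have := hs.2
    simpa [hr.ne'] using this
  have hre : (1 - (r : ℂ) * z).re < 0 := by
    refine lt_of_le_of_ne hs.1 fun h0 => h ?_
    exact Complex.ext h0 hs.2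
  have h1 := continuousWithinAt_log_of_re_neg_of_im_zero hre hs.2
  exact Tendsto.comp h1 (tendsto_nhdsWithin_iff.2 ⟨hc.continuousAt,
    Eventually.of_forall fun s => by simp [hz]⟩)

theorem hasDerivAt_dilog_ray {z : ℂ} {r : ℝ} (hr : 0 < r) (h : 1 - (r : ℂ) * z ≠ 0) :
    HasDerivAt (fun s : ℝ => dilog (s * z)) (-(log (1 - (r : ℂ) * z) / (r : ℂ))) r := by
  simp_rw [dilog_ofReal_mul]
  refine (integral_hasDerivAt_right (intervalIntegrable_log_one_sub_div z hr.le) ?_ ?_).neg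
  · exact Measurable.stronglyMeasurable (by fun_prop) |>.stronglyMeasurableAtFilter
  · exact (continuousAt_log_one_sub_ofReal_mul hr h).div (by fun_prop) (by exact_mod_cast hr.ne')

theorem continuousOn_dilog_ray (z : ℂ) (R : ℝ) (hR : 0 ≤ R) :
    ContinuousOn (fun s : ℝ => dilog (s * z)) (Icc 0 R) := by
  simp_rw [dilog_ofReal_mul]
  have h := intervalIntegrable_log_one_sub_div z hR
  have := (continuousOn_primitive_interval (a := 0) (b := R) (μ := volume)
    (f := fun s : ℝ => log (1 - (s : ℂ) * z) / (s : ℂ)) ?_).neg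
  · rwa [uIcc_of_le hR] at this
  · rw [uIcc_of_le hR, integrableOn_Icc_iff_integrableOn_Ioc,
      ← intervalIntegrable_iff_integrableOn_Ioc_of_le hR]
    exact h

/-- Termwise integration of the logarithm series; the integrals of the norms are at most `1/(n+1)²`,
which also covers the unit circle. -/
theorem dilog_eq_dilogSeries {z : ℂ} (hz : ‖z‖ ≤ 1) : dilog z = dilogSeries z := by
  have hI : ∀ n : ℕ, ∫ t in Ioo (0 : ℝ) 1, t ^ n = 1 / ((n : ℝ) + 1) := by
    intro n
    rw [← integral_Ioc_eq_integral_Ioo, ← intervalIntegral.integral_of_le zero_le_one, integral_pow]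
    simp
  have hint : ∀ n : ℕ, IntegrableOn (fun t : ℝ => t ^ n) (Ioo 0 1) := fun n =>
    ((continuous_pow n).integrableOn_Icc (a := 0) (b := 1)).mono_set Ioo_subset_Icc_self
  have h := hasSum_integral_of_summable_integral_norm (μ := volume.restrict (Ioo (0 : ℝ) 1))
    (F := fun (n : ℕ) (t : ℝ) => ((t ^ n : ℝ) : ℂ) * (z ^ (n + 1) / ((n : ℂ) + 1)))
    (fun n => (hint n).ofReal.mul_const _) ?_
  · have h1 := h.tsum_eq
    have e1 : ∀ n : ℕ, ∫ t in Ioo (0 : ℝ) 1, ((t ^ n : ℝ) : ℂ) * (z ^ (n + 1) / ((n : ℂ) + 1)) =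
        z ^ (n + 1) / ((n : ℂ) + 1) ^ 2 := by
      intro n
      rw [MeasureTheory.integral_mul_const, integral_complex_ofReal, hI]
      have : (n : ℂ) + 1 ≠ 0 := Nat.cast_add_one_ne_zero n
      push_cast
      field_simp
    simp_rw [e1] at h1
    rw [dilogSeries, h1, dilog, intervalIntegral.integral_of_le zero_le_one,
      integral_Ioc_eq_integral_Ioo, ← MeasureTheory.integral_neg]
    refine setIntegral_congr_fun measurableSet_Ioo fun t ht => ?_
    have ht0 : (t : ℂ) ≠ 0 := by exact_mod_cast ht.1.ne'
    have hn : ‖(t : ℂ) * z‖ < 1 := by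
      rw [norm_mul, norm_real, Real.norm_of_nonneg ht.1.le]
      nlinarith [ht.1, ht.2, norm_nonneg z]
    have hs := (hasSum_taylorSeries_neg_log' hn).div_const (t : ℂ)
    rw [← neg_div, ← hs.tsum_eq]
    refine tsum_congr fun n => ?_
    push_cast
    rw [mul_pow]
    field_simp
    ring
  · have e2 : ∀ n : ℕ, ∫ t in Ioo (0 : ℝ) 1, ‖((t ^ n : ℝ) : ℂ) * (z ^ (n + 1) / ((n : ℂ) + 1))‖ =
        ‖z‖ ^ (n + 1) / ((n : ℝ) + 1) ^ 2 := by
      intro n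
      have : ∀ t ∈ Ioo (0 : ℝ) 1, ‖((t ^ n : ℝ) : ℂ) * (z ^ (n + 1) / ((n : ℂ) + 1))‖ =
          t ^ n * (‖z‖ ^ (n + 1) / ((n : ℝ) + 1)) := by
        intro t ht
        have : ‖(n : ℂ) + 1‖ = (n : ℝ) + 1 := by exact_mod_cast Complex.norm_natCast (n + 1)
        rw [norm_mul, norm_real, Real.norm_of_nonneg (pow_nonneg ht.1.le n), norm_div, norm_pow,
          this]
      rw [setIntegral_congr_fun measurableSet_Ioo this, MeasureTheory.integral_mul_const, hI]
      field_simp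
    simp_rw [e2]
    have hs : Summable fun n : ℕ => 1 / ((n + 1 : ℕ) : ℝ) ^ 2 :=
      (summable_nat_add_iff 1).2 (Real.summable_one_div_nat_pow.2 one_lt_two)
    refine hs.of_nonneg_of_le (fun n => by positivity) fun n => ?_
    push_cast
    gcongr
    exact pow_le_one₀ (norm_nonneg z) hz

theorem one_sub_mul_mem_slitPlane {z : ℂ} (hz : 1 - z ∈ slitPlane) {t : ℝ}
    (ht : t ∈ Icc (0 : ℝ) 1) : 1 - (t : ℂ) * z ∈ slitPlane := by
  have := starConvex_one_slitPlane hz (sub_nonneg.2 ht.2) ht.1 (by ring : 1 - t + t = 1)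
  convert! this using 1
  simp only [real_smul]
  push_cast; ring

/-- Differentiation under the integral. The segment from `1` to `1 - z` is compact in the slit
plane, so a margin `δ` serves for all `t` and bounds the differentiated integrand by `2/δ`. -/
theorem hasDerivAt_dilog {z : ℂ} (hz : 1 - z ∈ slitPlane) (hz0 : z ≠ 0) :
    HasDerivAt dilog (-(log (1 - z) / z)) z := by
  set K : Set ℂ := (fun t : ℝ => 1 - (t : ℂ) * z) '' Icc 0 1 with hK
  have hKc : IsCompact K := isCompact_Icc.image (by fun_prop)
  obtain ⟨δ, hδ, hsub⟩ := hKc.exists_thickening_subset_open isOpen_slitPlane (by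
    rintro _ ⟨t, ht, rfl⟩; exact one_sub_mul_mem_slitPlane hz ht)
  have hball : ∀ t ∈ Icc (0 : ℝ) 1, Metric.ball (1 - (t : ℂ) * z) δ ⊆ slitPlane := fun t ht =>
    (Metric.ball_subset_thickening (mem_image_of_mem _ ht) δ).trans hsub
  have hclose : ∀ t ∈ Icc (0 : ℝ) 1, ∀ w ∈ Metric.ball z (δ / 2),
      dist (1 - (t : ℂ) * w) (1 - (t : ℂ) * z) < δ / 2 := by
    intro t ht w hw
    rw [Metric.mem_ball, dist_eq] at hw
    rw [dist_eq, show 1 - (t : ℂ) * w - (1 - (t : ℂ) * z) = (t : ℂ) * -(w - z) by ring, norm_mul,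
      norm_real, Real.norm_of_nonneg ht.1, norm_neg]
    nlinarith [ht.1, ht.2, norm_nonneg (w - z)]
  have hmem : ∀ t ∈ Icc (0 : ℝ) 1, ∀ w ∈ Metric.ball z (δ / 2), 1 - (t : ℂ) * w ∈ slitPlane :=
    fun t ht w hw => hball t ht (by
      rw [Metric.mem_ball]; linarith [hclose t ht w hw])
  have hlow : ∀ t ∈ Icc (0 : ℝ) 1, ∀ w ∈ Metric.ball z (δ / 2), δ / 2 ≤ ‖1 - (t : ℂ) * w‖ := by
    intro t ht w hw
    by_contra! hlt
    have h0 : (0 : ℂ) ∈ Metric.ball (1 - (t : ℂ) * z) δ := by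
      rw [Metric.mem_ball]
      calc dist 0 (1 - (t : ℂ) * z) ≤ dist 0 (1 - (t : ℂ) * w) +
            dist (1 - (t : ℂ) * w) (1 - (t : ℂ) * z) := dist_triangle _ _ _
        _ < δ / 2 + δ / 2 := by
            refine add_lt_add ?_ (hclose t ht w hw)
            rwa [dist_zero_left]
        _ = δ := by ring
    exact slitPlane_ne_zero (hball t ht h0) rfl
  have key := intervalIntegral.hasDerivAt_integral_of_dominated_loc_of_deriv_le
    (μ := volume) (a := 0) (b := 1) (F := fun (w : ℂ) (t : ℝ) => log (1 - (t : ℂ) * w) / (t : ℂ))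
    (F' := fun (w : ℂ) (t : ℝ) => -1 / (1 - (t : ℂ) * w)) (x₀ := z) (bound := fun _ => 1 / (δ / 2))
    (Metric.ball_mem_nhds z (half_pos hδ))
    (Eventually.of_forall fun w => (Measurable.aestronglyMeasurable (by fun_prop)))
    (intervalIntegrable_log_one_sub_div z zero_le_one)
    (Measurable.aestronglyMeasurable (by fun_prop)) ?_ intervalIntegrable_const ?_
  · have hd := key.2.neg
    refine hd.congr_deriv ?_
    have hF : ∀ t ∈ uIcc (0 : ℝ) 1, HasDerivAt (fun t : ℝ => log (1 - (t : ℂ) * z) / z)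
        (-1 / (1 - (t : ℂ) * z)) t := by
      intro t ht
      rw [uIcc_of_le zero_le_one] at ht
      have hm := one_sub_mul_mem_slitPlane hz ht
      have h1 : HasDerivAt (fun t : ℝ => 1 - (t : ℂ) * z) (-(1 * z)) t :=
        (((hasDerivAt_id (t : ℂ)).mul_const z).const_sub 1).comp_ofReal
      refine ((h1.clog_real hm).div_const z).congr_deriv ?_
      have := slitPlane_ne_zero hm
      field_simp
    rw [integral_eq_sub_of_hasDerivAt hF]
    · simp
    · refine ContinuousOn.intervalIntegrable ?_
      rw [uIcc_of_le zero_le_one]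
      exact continuousOn_const.div (by fun_prop) fun t ht =>
        slitPlane_ne_zero (one_sub_mul_mem_slitPlane hz ht)
  · refine Eventually.of_forall fun t ht w hw => ?_
    rw [uIoc_of_le zero_le_one] at ht
    have := hlow t ⟨ht.1.le, ht.2⟩ w hw
    rw [norm_div, norm_neg, norm_one]
    gcongr
  · refine Eventually.of_forall fun t ht w hw => ?_
    rw [uIoc_of_le zero_le_one] at ht
    have hm := hmem t ⟨ht.1.le, ht.2⟩ w hw
    have h1 : HasDerivAt (fun w : ℂ => 1 - (t : ℂ) * w) (-((t : ℂ) * 1)) w :=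
      ((hasDerivAt_id w).const_mul (t : ℂ)).const_sub 1
    refine ((h1.clog hm).div_const (t : ℂ)).congr_deriv ?_
    have := slitPlane_ne_zero hm
    have ht0 : (t : ℂ) ≠ 0 := by exact_mod_cast ht.1.ne'
    field_simp

theorem continuousAt_dilog_zero : ContinuousAt dilog 0 := by
  have hs : Summable fun n : ℕ => 1 / ((n + 1 : ℕ) : ℝ) ^ 2 :=
    (summable_nat_add_iff 1).2 (Real.summable_one_div_nat_pow.2 one_lt_two)
  have h : ContinuousOn dilogSeries (Metric.closedBall 0 1) := by
    refine continuousOn_tsum (fun n => by fun_prop) hs fun n z hz => ?_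
    rw [mem_closedBall_zero_iff] at hz
    have : ‖(n : ℂ) + 1‖ = (n : ℝ) + 1 := by exact_mod_cast Complex.norm_natCast (n + 1)
    rw [norm_div, norm_pow, norm_pow, this]
    push_cast
    gcongr
    exact pow_le_one₀ (norm_nonneg z) hz
  have h0 := h.continuousAt (Metric.closedBall_mem_nhds (0 : ℂ) one_pos)
  refine h0.congr ?_
  filter_upwards [Metric.closedBall_mem_nhds (0 : ℂ) one_pos] with z hz
  exact (dilog_eq_dilogSeries (by simpa using hz)).symm

/-! ### Reflection and inversion formulas. -/

/-- Reflection of the principal logarithm of `1 - e^{-y}`. -/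
theorem log_one_sub_exp_neg {y : ℂ} (hy : y.re < 0) :
    log (1 - exp (-y)) = log (1 - exp y) -
      (y - Real.pi * I * (2 * (⌊y.im / (2 * Real.pi)⌋ : ℂ) + 1)) := by
  have hpi := Real.pi_pos
  set j := ⌊y.im / (2 * Real.pi)⌋ with hj
  have hj1 : (j : ℝ) * (2 * Real.pi) ≤ y.im := by
    rw [← le_div_iff₀ (by positivity)]; exact Int.floor_le _
  have hj2 : y.im < ((j : ℝ) + 1) * (2 * Real.pi) := by
    rw [← div_lt_iff₀ (by positivity)]; exact Int.lt_floor_add_one _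
  -- The logarithm of `-e^{-y}` with imaginary part in `(-π, π]`; the factorization used is `1 -
  -- e^{-y} = (1 - e^y)(-e^{-y})`.
  set v := -(y - Real.pi * I * (2 * (j : ℂ) + 1)) with hv
  have hvim : v.im = Real.pi - (y.im - j * (2 * Real.pi)) := by
    simp [hv]; ring
  have hexp : exp v = -exp (-y) := by
    rw [show v = -y + (j * (2 * Real.pi * I) + Real.pi * I) by rw [hv]; ring, exp_add, exp_add,
      exp_int_mul_two_pi_mul_I, exp_pi_mul_I]
    ring
  have hlog : log (exp v) = v := log_exp (by rw [hvim]; linarith) (by rw [hvim]; linarith)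
  have hxre : 0 < (1 - exp y).re := by
    have h1 := (re_le_norm (exp y))
    rw [norm_exp] at h1
    have h2 := Real.exp_lt_exp.2 hy
    rw [Real.exp_zero] at h2
    simp only [sub_re, one_re]
    linarith
  have hx0 : 1 - exp y ≠ 0 := fun h => by rw [h] at hxre; simp at hxre
  have harg : |arg (1 - exp y)| < Real.pi / 2 := abs_arg_lt_pi_div_two_iff.2 (Or.inl hxre)
  rw [abs_lt] at harg
  have hargv : arg (exp v) = Real.pi - (y.im - j * (2 * Real.pi)) := by
    rw [← log_im, hlog, hvim]
  have him : (1 - exp y).im = -(Real.exp y.re * Real.sin (y.im - j * (2 * Real.pi))) := by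
    rw [Real.sin_sub_int_mul_two_pi]
    simp [exp_im]
  -- The two arguments have opposite signs (or vanish), so their sum does not leave `(-π, π]`.
  have hsum : arg (1 - exp y) + arg (exp v) ∈ Ioc (-Real.pi) Real.pi := by
    rw [hargv, arg_of_re_nonneg hxre.le] at *
    rcases le_or_gt (y.im - j * (2 * Real.pi)) Real.pi with h | h
    · have : Real.arcsin ((1 - exp y).im / ‖1 - exp y‖) ≤ 0 := by
        rw [Real.arcsin_nonpos, him]
        refine div_nonpos_of_nonpos_of_nonneg ?_ (norm_nonneg _)
        have := Real.sin_nonneg_of_nonneg_of_le_pi (sub_nonneg.2 hj1) h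
        have := mul_nonneg (Real.exp_pos y.re).le this
        linarith
      constructor <;> linarith
    · have : 0 ≤ Real.arcsin ((1 - exp y).im / ‖1 - exp y‖) := by
        rw [Real.arcsin_nonneg, him]
        refine div_nonneg ?_ (norm_nonneg _)
        have h3 : Real.sin (y.im - j * (2 * Real.pi)) ≤ 0 := by
          rw [← Real.sin_sub_two_pi]
          exact Real.sin_nonpos_of_nonpos_of_neg_pi_le (by linarith) (by linarith)
        have := mul_nonneg (Real.exp_pos y.re).le (neg_nonneg.2 h3)
        linarith
      constructor <;> linarith
  have := log_mul hx0 (exp_ne_zero v) hsum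
  rw [hlog] at this
  rw [sub_eq_add_neg (log _), ← hv, ← this, hexp]
  congr 1
  have : exp y * exp (-y) = 1 := by rw [← exp_add]; simp
  linear_combination -this

/-- The sum is `2 ∑ cos(nθ)/n²`, the Fourier series of the Bernoulli polynomial `B₂`. -/
theorem dilogSeries_unit {θ : ℝ} (h0 : 0 ≤ θ) (h1 : θ ≤ 2 * Real.pi) :
    dilogSeries (exp (-(θ * I))) + dilogSeries (exp (θ * I)) =
      -(Real.pi : ℂ) ^ 2 / 6 - (θ * I - Real.pi * I) ^ 2 / 2 := by
  have hpi := Real.pi_pos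
  have hx : θ / (2 * Real.pi) ∈ Icc (0 : ℝ) 1 :=
    ⟨by positivity, by rw [div_le_one (by positivity)]; exact h1⟩
  have h := hasSum_one_div_nat_pow_mul_cos one_ne_zero hx
  rw [show (2 * 1 : ℕ) = 2 from rfl] at h
  have hb : Polynomial.eval (θ / (2 * Real.pi)) (Polynomial.map (algebraMap ℚ ℝ)
      (Polynomial.bernoulli 2)) = (θ / (2 * Real.pi)) ^ 2 - θ / (2 * Real.pi) + 6⁻¹ :=
    bernoulliFun_two _
  rw [hb, ← hasSum_nat_add_iff' 1] at h
  simp only [Finset.range_one, Finset.sum_singleton, Nat.cast_zero] at h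
  have hs : ∀ w : ℂ, ‖w‖ = 1 → Summable fun n : ℕ => w ^ (n + 1) / ((n : ℂ) + 1) ^ 2 := by
    intro w hw
    have hs : Summable fun n : ℕ => 1 / ((n + 1 : ℕ) : ℝ) ^ 2 :=
      (summable_nat_add_iff 1).2 (Real.summable_one_div_nat_pow.2 one_lt_two)
    refine Summable.of_norm_bounded hs fun n => ?_
    have : ‖(n : ℂ) + 1‖ = (n : ℝ) + 1 := by exact_mod_cast Complex.norm_natCast (n + 1)
    rw [norm_div, norm_pow, norm_pow, this, hw]
    push_cast
    simp
  have e1 : ‖exp (-(θ * I))‖ = 1 := by rw [norm_exp]; simp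
  have e2 : ‖exp (θ * I)‖ = 1 := norm_exp_ofReal_mul_I θ
  unfold dilogSeries
  rw [← (hs _ e1).tsum_add (hs _ e2)]
  have h2 := (hasSum_ofReal.2 h).mul_left 2
  convert! h2.tsum_eq using 1
  · refine tsum_congr fun n => ?_
    rw [← exp_nat_mul, ← exp_nat_mul]
    have : 2 * Real.pi * ((n + 1 : ℕ) : ℝ) * (θ / (2 * Real.pi)) = ((n + 1 : ℕ) : ℝ) * θ := by
      field_simp
    rw [this, ofReal_mul, ofReal_cos, Complex.cos]
    push_cast
    ring_nf
  · have : (Real.pi : ℂ) ≠ 0 := by exact_mod_cast hpi.ne'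
    push_cast
    field_simp
    simp [Nat.factorial]
    ring

/-- The inversion formula for the dilogarithm, on all branches of the logarithm. -/
theorem dilog_exp_neg {y : ℂ} (hy : y.re ≤ 0) :
    dilog (exp (-y)) = -dilog (exp y) - (Real.pi : ℂ) ^ 2 / 6 -
      (y - Real.pi * I * (2 * (⌊y.im / (2 * Real.pi)⌋ : ℂ) + 1)) ^ 2 / 2 := by
  have hpi := Real.pi_pos
  set j := ⌊y.im / (2 * Real.pi)⌋ with hj
  have hj1 : (j : ℝ) * (2 * Real.pi) ≤ y.im := by
    rw [← le_div_iff₀ (by positivity)]; exact Int.floor_le _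
  have hj2 : y.im < ((j : ℝ) + 1) * (2 * Real.pi) := by
    rw [← div_lt_iff₀ (by positivity)]; exact Int.lt_floor_add_one _
  set ω := exp (y.im * I) with hω
  set ω' := exp (-(y.im * I)) with hω'
  have hpos : ∀ a : ℝ, ((Real.exp (-a) : ℝ) : ℂ) * ω' = exp (-((a : ℂ) + y.im * I)) := by
    intro a; rw [hω', ofReal_exp, ← exp_add]; push_cast; ring_nf
  have hneg : ∀ a : ℝ, ((Real.exp a : ℝ) : ℂ) * ω = exp ((a : ℂ) + y.im * I) := by
    intro a; rw [hω, ofReal_exp, ← exp_add]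
  have hne : ∀ a : ℝ, a ≠ 0 → ∀ v : ℂ, ‖v‖ = 1 → 1 - ((Real.exp a : ℝ) : ℂ) * v ≠ 0 := by
    intro a ha v hv h
    have : ‖((Real.exp a : ℝ) : ℂ) * v‖ = 1 := by rw [← sub_eq_zero.1 h]; simp
    rw [norm_mul, hv, norm_real, Real.norm_of_nonneg (Real.exp_pos a).le, mul_one,
      Real.exp_eq_one_iff] at this
    exact ha this
  have nω : ‖ω‖ = 1 := norm_exp_ofReal_mul_I _
  have nω' : ‖ω'‖ = 1 := by rw [hω', norm_exp]; simp
  let q : ℝ → ℂ := fun a => (a : ℂ) + y.im * I - Real.pi * I * (2 * (j : ℂ) + 1)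
  -- The defect of the formula along the horizontal line through `y`. It vanishes at `a = 0` by
  -- `dilogSeries_unit`, and for `a < 0` its derivative is zero by reflection of the logarithm. Ray
  -- derivatives suffice, so `e^{-y}` may lie on the cut.
  let E : ℝ → ℂ := fun a => dilog (((Real.exp (-a) : ℝ) : ℂ) * ω') +
    dilog (((Real.exp a : ℝ) : ℂ) * ω) + (Real.pi : ℂ) ^ 2 / 6 + q a ^ 2 / 2
  have hE0 : E 0 = 0 := by
    have hθ := dilogSeries_unit (θ := y.im - j * (2 * Real.pi)) (by linarith) (by linarith)
    have p1 : exp (((y.im - j * (2 * Real.pi) : ℝ) : ℂ) * I) = ω := by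
      rw [hω, show ((y.im - j * (2 * Real.pi) : ℝ) : ℂ) * I =
        y.im * I - j * (2 * Real.pi * I) by push_cast; ring, exp_sub, exp_int_mul_two_pi_mul_I,
        div_one]
    have p2 : exp (-(((y.im - j * (2 * Real.pi) : ℝ) : ℂ) * I)) = ω' := by
      rw [exp_neg, p1, hω, hω', exp_neg]
    rw [p1, p2, ← dilog_eq_dilogSeries nω.le, ← dilog_eq_dilogSeries nω'.le] at hθ
    simp only [E, q, neg_zero, Real.exp_zero, ofReal_one, one_mul, ofReal_zero, zero_add]
    push_cast at hθ
    linear_combination hθ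
  have hcont : ContinuousOn E (Icc y.re 0) := by
    have c1 := (continuousOn_dilog_ray ω' (Real.exp (-y.re)) (Real.exp_pos _).le).comp
      (f := fun a : ℝ => Real.exp (-a)) (s := Icc y.re 0) (by fun_prop) (fun a ha =>
        ⟨(Real.exp_pos _).le, Real.exp_le_exp.2 (neg_le_neg ha.1)⟩)
    have c2 := (continuousOn_dilog_ray ω 1 zero_le_one).comp
      (f := fun a : ℝ => Real.exp a) (s := Icc y.re 0) (by fun_prop) (fun a ha =>
        ⟨(Real.exp_pos _).le, by simpa using ha.2⟩)
    exact ((c1.add c2).add continuousOn_const).add (Continuous.continuousOn (by fun_prop))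
  have hder : ∀ a ∈ Ioo y.re 0, HasDerivAt E 0 a := by
    intro a ha
    have d1 := (hasDerivAt_dilog_ray (Real.exp_pos (-a)) (hne (-a) (by linarith [ha.2]) ω' nω')).scomp
      a (hasDerivAt_neg a).exp
    have d2 := (hasDerivAt_dilog_ray (Real.exp_pos a) (hne a ha.2.ne ω nω)).scomp
      a (Real.hasDerivAt_exp a)
    have dq : HasDerivAt q 1 a :=
      (((hasDerivAt_id (a : ℂ)).comp_ofReal).add_const _).sub_const _
    refine (((d1.add d2).add_const _).add ((dq.pow 2).div_const 2)).congr_deriv ?_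
    have hl := log_one_sub_exp_neg (y := (a : ℂ) + y.im * I) (by simpa using ha.2)
    have e1 : ((a : ℂ) + y.im * I).im = y.im := by simp
    rw [e1, ← hj, ← hpos, ← hneg] at hl
    have n1 : ((Real.exp a : ℝ) : ℂ) ≠ 0 := by exact_mod_cast (Real.exp_pos a).ne'
    have n2 : ((Real.exp (-a) : ℝ) : ℂ) ≠ 0 := by exact_mod_cast (Real.exp_pos (-a)).ne'
    rw [hl]
    simp only [q, real_smul]
    generalize log (1 - ((Real.exp a : ℝ) : ℂ) * ω) = L
    push_cast at n1 n2 ⊢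
    field_simp
    ring
  have hconst := integral_eq_sub_of_hasDerivAt_of_le hy hcont hder intervalIntegrable_const
  rw [intervalIntegral.integral_zero, hE0] at hconst
  have hEy : E y.re = 0 := by linear_combination hconst
  have hyy : (y.re : ℂ) + y.im * I = y := re_add_im y
  simp only [E, q, hpos, hneg, hyy] at hEy
  linear_combination hEy

/-! ### The explicit branches with cuts in direction `-β`. -/

/-- The branch of `log (1 - e^{-y})` with cuts `2πin + β ℝ_{≤ 0}`. -/
def logBranch (β y : ℂ) : ℂ :=
  if 0 ≤ y.re then log (1 - exp (-y))
  else log (1 - exp y) - (y - Real.pi * I * (2 * (⌊latticeCoord β y⌋ : ℂ) + 1))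

/-- The branch of `Li₂(e^{-y})` with cuts `2πin + β ℝ_{≤ 0}`. -/
def dilogBranch (β y : ℂ) : ℂ :=
  if 0 ≤ y.re then dilog (exp (-y))
  else -dilog (exp y) - (Real.pi : ℂ) ^ 2 / 6 -
    (y - Real.pi * I * (2 * (⌊latticeCoord β y⌋ : ℂ) + 1)) ^ 2 / 2

/-- The formula on the left is the reflected principal logarithm except that the strip is indexed by
`latticeCoord` instead of `Im y / (2π)`. -/
theorem logBranch_eq_log {β y : ℂ}
    (h : 0 ≤ y.re ∨ ⌊latticeCoord β y⌋ = ⌊y.im / (2 * Real.pi)⌋) :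
    logBranch β y = log (1 - exp (-y)) := by
  unfold logBranch
  split_ifs with hy
  · rfl
  · rw [log_one_sub_exp_neg (not_le.1 hy), h.resolve_left hy]

theorem dilogBranch_eq_dilog {β y : ℂ}
    (h : 0 ≤ y.re ∨ ⌊latticeCoord β y⌋ = ⌊y.im / (2 * Real.pi)⌋) :
    dilogBranch β y = dilog (exp (-y)) := by
  unfold dilogBranch
  split_ifs with hy
  · rfl
  · rw [dilog_exp_neg (not_le.1 hy).le, h.resolve_left hy]

theorem exp_neg_ne_one {y : ℂ} (hp : y ∉ periods) : exp (-y) ≠ 1 := by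
  intro h
  obtain ⟨n, hn⟩ := exp_eq_one_iff.1 h
  exact hp ⟨-n, by push_cast; linear_combination -hn⟩

theorem neg_mem_periods {y : ℂ} (hp : -y ∈ periods) : y ∈ periods := by
  obtain ⟨n, hn⟩ := hp
  exact ⟨-n, by push_cast; linear_combination -hn⟩

theorem re_one_sub_exp_neg_pos {y : ℂ} (hy : 0 ≤ y.re) (hp : y ∉ periods) :
    0 < (1 - exp (-y)).re := by
  have h1 : ‖exp (-y)‖ ≤ 1 := by rw [norm_exp]; simpa using hy
  have h2 := re_le_norm (exp (-y))
  simp only [sub_re, one_re]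
  refine sub_pos.2 (lt_of_le_of_ne (h2.trans h1) fun h => exp_neg_ne_one hp ?_)
  have h3 : (exp (-y)).im = 0 := by
    have h4 := normSq_eq_norm_sq (exp (-y))
    rw [normSq_apply, h] at h4
    have : ‖exp (-y)‖ ^ 2 ≤ 1 := pow_le_one₀ (norm_nonneg _) h1
    nlinarith
  exact Complex.ext h h3

theorem one_sub_exp_neg_mem_slitPlane {y : ℂ} (hy : 0 ≤ y.re) (hp : y ∉ periods) :
    1 - exp (-y) ∈ slitPlane :=
  mem_slitPlane_iff.2 (Or.inl (re_one_sub_exp_neg_pos hy hp))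

theorem exp_sub_one_ne_zero {y : ℂ} (hp : y ∉ periods) : exp y - 1 ≠ 0 := fun h =>
  exp_neg_ne_one hp (by rw [exp_neg, sub_eq_zero.1 h, inv_one])

theorem hasDerivAt_log_one_sub_exp_neg {y : ℂ} (h : 1 - exp (-y) ∈ slitPlane) :
    HasDerivAt (fun w => log (1 - exp (-w))) (1 / (exp y - 1)) y := by
  have h1 : HasDerivAt (fun w : ℂ => 1 - exp (-w)) (-(exp (-y) * -1)) y :=
    ((hasDerivAt_neg y).cexp).const_sub 1
  refine (h1.clog h).congr_deriv ?_
  have h2 := slitPlane_ne_zero h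
  rw [exp_neg] at *
  have h3 := exp_ne_zero y
  have h4 : exp y - 1 ≠ 0 := by
    intro h0; apply h2; rw [sub_eq_zero.1 h0]; simp
  have h5 : 1 - (exp y)⁻¹ = (exp y - 1) / exp y := by field_simp
  rw [h5]
  field_simp

theorem hasDerivAt_dilog_exp_neg {y : ℂ} (h : 1 - exp (-y) ∈ slitPlane) :
    HasDerivAt (fun w => dilog (exp (-w))) (log (1 - exp (-y))) y := by
  refine ((hasDerivAt_dilog h (exp_ne_zero _)).comp y (hasDerivAt_neg y).cexp).congr_deriv ?_
  have := exp_ne_zero (-y)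
  field_simp

theorem eventually_floor_eq {X : Type*} [TopologicalSpace X] {f : X → ℝ} {x : X}
    (hf : ContinuousAt f x) (hx : f x ∉ range ((↑) : ℤ → ℝ)) : ∀ᶠ w in 𝓝 x, ⌊f w⌋ = ⌊f x⌋ := by
  have h1 : (⌊f x⌋ : ℝ) < f x :=
    lt_of_le_of_ne (Int.floor_le _) fun h => hx ⟨_, h⟩
  filter_upwards [hf.eventually (Ioo_mem_nhds h1 (Int.lt_floor_add_one _))] with w hw
  exact Int.floor_eq_iff.2 ⟨hw.1.le, hw.2⟩

section Left

variable {β y : ℂ}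

/-- The analytic expression of the branches near a point with negative real part. -/
theorem hasDerivAt_left (hy : y.re < 0) (c : ℂ) :
    HasDerivAt (fun w => log (1 - exp w) - (w - c)) (1 / (exp y - 1)) y ∧
    HasDerivAt (fun w => -dilog (exp w) - (Real.pi : ℂ) ^ 2 / 6 - (w - c) ^ 2 / 2)
      (log (1 - exp y) - (y - c)) y := by
  have hp : -y ∉ periods := fun ⟨n, hn⟩ => by
    have := congrArg re hn
    simp at this
    linarith
  have hs := one_sub_exp_neg_mem_slitPlane (y := -y) (by simpa using hy.le) hp
  have h1 := (hasDerivAt_log_one_sub_exp_neg hs).comp y (hasDerivAt_neg y)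
  have h2 := (hasDerivAt_dilog_exp_neg hs).comp y (hasDerivAt_neg y)
  simp only [Function.comp_def, neg_neg] at h1 h2
  have h3 : HasDerivAt (fun w : ℂ => w - c) 1 y := (hasDerivAt_id y).sub_const c
  refine ⟨(h1.sub h3).congr_deriv ?_,
    ((h2.neg.sub_const _).sub ((h3.pow 2).div_const 2)).congr_deriv ?_⟩
  · have h5 := exp_sub_one_ne_zero (fun h => hp (neg_mem_periods (by rwa [neg_neg])))
    have h6 := exp_ne_zero y
    have h7 : (exp y)⁻¹ - 1 = -(exp y - 1) / exp y := by field_simp; ring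
    rw [exp_neg, h7]
    field_simp
    ring
  · simp

/-- The factor on the right is positive, so the prescribed side of a cut is the side where
`latticeCoord` increases. -/
theorem latticeCoord_sub (hβ : 0 < β.re) (w y : ℂ) :
    latticeCoord β w - latticeCoord β y =
      ((w - y) / β).im * (normSq β / (2 * Real.pi * β.re)) := by
  have hpi := Real.pi_pos
  have : normSq β ≠ 0 := (normSq_pos.2 fun h => by simp [h] at hβ).ne'
  unfold latticeCoord
  rw [div_im]
  simp
  field_simp
  ring

/-- The floor function is continuous from the right, so the strip index is constant on the
prescribed side. -/
theorem eventually_left (hβ : 0 < β.re) (hy : y.re < 0) :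
    ∀ᶠ w in 𝓝[{w | 0 ≤ ((w - y) / β).im}] y,
      w.re < 0 ∧ ⌊latticeCoord β w⌋ = ⌊latticeCoord β y⌋ := by
  have hu := (continuous_latticeCoord β).continuousAt (x := y)
  filter_upwards [self_mem_nhdsWithin,
    nhdsWithin_le_nhds (continuous_re.continuousAt.eventually (gt_mem_nhds hy)),
    nhdsWithin_le_nhds (hu.eventually (gt_mem_nhds (Int.lt_floor_add_one (latticeCoord β y))))]
    with w hw1 hw2 hw3
  refine ⟨hw2, Int.floor_eq_iff.2 ⟨?_, hw3⟩⟩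
  have h1 := latticeCoord_sub hβ w y
  have h2 : 0 ≤ ((w - y) / β).im * (normSq β / (2 * Real.pi * β.re)) :=
    mul_nonneg hw1 (div_nonneg (normSq_nonneg β) (by have := Real.pi_pos; positivity))
  have := Int.floor_le (latticeCoord β y)
  linarith

theorem logBranch_left {w : ℂ} {j : ℤ} (hw : w.re < 0) (hj : ⌊latticeCoord β w⌋ = j) :
    logBranch β w = log (1 - exp w) - (w - Real.pi * I * (2 * (j : ℂ) + 1)) := by
  rw [logBranch, if_neg (not_le.2 hw), hj]

theorem dilogBranch_left {w : ℂ} {j : ℤ} (hw : w.re < 0) (hj : ⌊latticeCoord β w⌋ = j) :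
    dilogBranch β w = -dilog (exp w) - (Real.pi : ℂ) ^ 2 / 6 -
      (w - Real.pi * I * (2 * (j : ℂ) + 1)) ^ 2 / 2 := by
  rw [dilogBranch, if_neg (not_le.2 hw), hj]

end Left

theorem hasDerivAt_branches {β y : ℂ} (hβ : 0 < β.re) (hy : y ∈ cutPlane β) :
    HasDerivAt (logBranch β) (1 / (exp y - 1)) y ∧
    HasDerivAt (dilogBranch β) (logBranch β y) y := by
  have hp := notMem_periods_of_mem_cutPlane β hy
  have hu := (continuous_latticeCoord β).continuousAt (x := y)
  rw [mem_cutPlane_iff hβ] at hy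
  rcases lt_or_ge y.re 0 with h | h
  · have hev : ∀ᶠ w in 𝓝 y, w.re < 0 ∧ ⌊latticeCoord β w⌋ = ⌊latticeCoord β y⌋ :=
      (continuous_re.continuousAt.eventually (gt_mem_nhds h)).and
        (eventually_floor_eq hu fun hm => hy ⟨hm, h.le⟩)
    obtain ⟨d1, d2⟩ := hasDerivAt_left h (Real.pi * I * (2 * (⌊latticeCoord β y⌋ : ℂ) + 1))
    rw [logBranch_left h rfl]
    exact ⟨d1.congr_of_eventuallyEq (hev.mono fun w hw => logBranch_left hw.1 hw.2),
      d2.congr_of_eventuallyEq (hev.mono fun w hw => dilogBranch_left hw.1 hw.2)⟩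
  · have hev : ∀ᶠ w in 𝓝 y, 0 ≤ w.re ∨ ⌊latticeCoord β w⌋ = ⌊w.im / (2 * Real.pi)⌋ := by
      -- On the imaginary axis both coordinates agree and are not integers, so both floors are
      -- locally constant and the principal formula holds on either side.
      rcases h.eq_or_lt with h0 | h0
      · have hm : latticeCoord β y ∉ range ((↑) : ℤ → ℝ) := fun hm => hy ⟨hm, h0.ge⟩
        have he : latticeCoord β y = y.im / (2 * Real.pi) := by
          unfold latticeCoord; rw [← h0]; simp
        filter_upwards [eventually_floor_eq hu hm,
          eventually_floor_eq (f := fun w : ℂ => w.im / (2 * Real.pi)) (x := y) (by fun_prop)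
            (by rwa [← he])] with w h1 h2
        right
        rw [h1, h2, he]
      · exact (continuous_re.continuousAt.eventually (lt_mem_nhds h0)).mono fun w hw => Or.inl hw.le
    have hs := one_sub_exp_neg_mem_slitPlane h hp
    rw [logBranch_eq_log (Or.inl h)]
    exact ⟨(hasDerivAt_log_one_sub_exp_neg hs).congr_of_eventuallyEq
      (hev.mono fun w hw => logBranch_eq_log hw),
      (hasDerivAt_dilog_exp_neg hs).congr_of_eventuallyEq
      (hev.mono fun w hw => dilogBranch_eq_dilog hw)⟩

theorem re_neg_of_notMem {β y : ℂ} (hβ : 0 < β.re) (hp : y ∉ periods) (hy : y ∉ cutPlane β) :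
    y.re < 0 := by
  rw [mem_cutPlane_iff hβ, not_not] at hy
  exact lt_of_le_of_ne hy.2 fun h => hp ((mem_periods_iff hβ).2 ⟨hy.1, h⟩)

theorem isBranch_logBranch {β : ℂ} (hβ : 0 < β.re) :
    IsBranch β (fun y => log (1 - exp (-y))) (logBranch β) where
  analytic y hy := (hasDerivAt_branches hβ hy).1.differentiableAt.differentiableWithinAt
  eq_of_re_pos y hy := logBranch_eq_log (Or.inl hy.le)
  boundary y hp := by
    by_cases hy : y ∈ cutPlane β
    · exact (hasDerivAt_branches hβ hy).1.continuousAt.continuousWithinAt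
    · have h := re_neg_of_notMem hβ hp hy
      exact (hasDerivAt_left h _).1.continuousAt.continuousWithinAt.congr_of_eventuallyEq
        ((eventually_left hβ h).mono fun w hw => logBranch_left hw.1 hw.2) (logBranch_left h rfl)

theorem isBranch_dilogBranch {β : ℂ} (hβ : 0 < β.re) :
    IsBranch β (fun y => dilogSeries (exp (-y))) (dilogBranch β) where
  analytic y hy := (hasDerivAt_branches hβ hy).2.differentiableAt.differentiableWithinAt
  eq_of_re_pos y hy := by
    rw [dilogBranch_eq_dilog (Or.inl hy.le)]
    refine dilog_eq_dilogSeries ?_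
    rw [norm_exp]
    simpa using hy.le
  boundary y hp := by
    by_cases hy : y ∈ cutPlane β
    · exact (hasDerivAt_branches hβ hy).2.continuousAt.continuousWithinAt
    · have h := re_neg_of_notMem hβ hp hy
      exact (hasDerivAt_left h _).2.continuousAt.continuousWithinAt.congr_of_eventuallyEq
        ((eventually_left hβ h).mono fun w hw => dilogBranch_left hw.1 hw.2)
        (dilogBranch_left h rfl)

theorem exp_logBranch (β : ℂ) {y : ℂ} (hp : y ∉ periods) :
    exp (logBranch β y) = 1 - exp (-y) := by
  rcases lt_or_ge y.re 0 with h | h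
  · have hne : 1 - exp y ≠ 0 := by
      rw [← neg_ne_zero, neg_sub]; exact exp_sub_one_ne_zero hp
    rw [logBranch_left h rfl, show log (1 - exp y) - (y - Real.pi * I *
      (2 * (⌊latticeCoord β y⌋ : ℂ) + 1)) = log (1 - exp y) + (-y +
        ((⌊latticeCoord β y⌋ : ℂ) * (2 * Real.pi * I) + Real.pi * I)) by ring, exp_add, exp_add,
      exp_add, exp_log hne, exp_int_mul_two_pi_mul_I, exp_pi_mul_I]
    have : exp y * exp (-y) = 1 := by rw [← exp_add]; simp
    linear_combination this
  · rw [logBranch_eq_log (Or.inl h), exp_log]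
    exact slitPlane_ne_zero (one_sub_exp_neg_mem_slitPlane h hp)

/-! ### Uniqueness of the branches and comparison with the principal ones. -/

/-- Moving in direction `β` carries every point into the right half-plane without meeting a cut. -/
theorem isPreconnected_cutPlane {β : ℂ} (hβ : 0 < β.re) : IsPreconnected (cutPlane β) := by
  refine isPreconnected_of_forall 1 fun y hy => ?_
  refine ⟨(fun t : ℝ => y + t * β) '' Ici 0 ∪ {w | 0 < w.re}, ?_, Or.inr (by simp),
    Or.inl ⟨0, by simp, by simp⟩, ?_⟩
  · rintro w (⟨t, ht, rfl⟩ | hw)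
    · exact add_mem_cutPlane hy ht
    · exact mem_cutPlane_of_re_pos hβ hw
  · refine IsPreconnected.union (y + ((|y.re| + 1) / β.re : ℝ) * β) ⟨_, ?_, rfl⟩ ?_ ?_ ?_
    · exact mem_Ici.2 (by positivity)
    · have := neg_abs_le y.re
      change 0 < (y + ((|y.re| + 1) / β.re : ℝ) * β).re
      rw [add_re, re_ofReal_mul, div_mul_cancel₀ _ hβ.ne']
      linarith
    · exact isPreconnected_Ici.image _ (by fun_prop)
    · exact (convex_halfSpace_re_gt 0).isPreconnected

theorem tendsto_add_mul_I {β : ℂ} (hβ : 0 < β.re) (y : ℂ) :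
    Tendsto (fun ε : ℝ => y + ε * (I * β)) (𝓝[>] 0) (𝓝[{w | 0 ≤ ((w - y) / β).im}] y) := by
  have hβ0 : β ≠ 0 := fun h => by simp [h] at hβ
  refine tendsto_nhdsWithin_iff.2 ⟨?_, ?_⟩
  · have : Continuous fun ε : ℝ => y + ε * (I * β) := by fun_prop
    have h := this.tendsto 0
    simp only [ofReal_zero, zero_mul, add_zero] at h
    exact h.mono_left nhdsWithin_le_nhds
  · filter_upwards [self_mem_nhdsWithin] with ε hε
    have : (y + ε * (I * β) - y) / β = ε * I := by field_simp; ring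
    rw [this]
    simpa using (mem_Ioi.1 hε).le

/-- For small `ε > 0` the lattice coordinate lies strictly between consecutive integers. -/
theorem eventually_add_mul_I_mem {β : ℂ} (hβ : 0 < β.re) (y : ℂ) :
    ∀ᶠ ε : ℝ in 𝓝[>] 0, y + ε * (I * β) ∈ cutPlane β := by
  have hβ0 : β ≠ 0 := fun h => by simp [h] at hβ
  have hpi := Real.pi_pos
  have ht := (tendsto_add_mul_I hβ y).mono_right nhdsWithin_le_nhds
  have hu := ((continuous_latticeCoord β).tendsto y).comp ht
  filter_upwards [self_mem_nhdsWithin,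
    hu.eventually (gt_mem_nhds (Int.lt_floor_add_one (latticeCoord β y)))] with ε hε h2
  rw [mem_cutPlane_iff hβ]
  rintro ⟨⟨n, hn⟩, -⟩
  simp only [Function.comp] at h2
  have h1 := latticeCoord_sub hβ (y + ε * (I * β)) y
  have e : (y + ε * (I * β) - y) / β = ε * I := by field_simp; ring
  have hpos : 0 < (ε * I : ℂ).im * (normSq β / (2 * Real.pi * β.re)) := by
    have := normSq_pos.2 hβ0
    have := mem_Ioi.1 hε
    simp; positivity
  rw [e] at h1
  rw [← hn] at h1 h2
  have h3 := Int.floor_le (latticeCoord β y)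
  have h4 : (⌊latticeCoord β y⌋ : ℝ) < n := by linarith
  have h5 : (n : ℝ) < ((⌊latticeCoord β y⌋ + 1 : ℤ) : ℝ) := by push_cast; exact h2
  have := Int.cast_lt.1 h4
  have := Int.cast_lt.1 h5
  omega

/-- A branch is unique outside `2πiℤ`. -/
theorem IsBranch.eq {β : ℂ} (hβ : 0 < β.re) {g G H : ℂ → ℂ} (hG : IsBranch β g G)
    (hH : IsBranch β g H) {y : ℂ} (hp : y ∉ periods) : G y = H y := by
  have hon : EqOn G H (cutPlane β) := by
    refine (hG.analytic.analyticOnNhd (isOpen_cutPlane hβ)).eqOn_of_preconnected_of_eventuallyEq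
      (hH.analytic.analyticOnNhd (isOpen_cutPlane hβ)) (isPreconnected_cutPlane hβ) (z₀ := 1)
      (mem_cutPlane_of_re_pos hβ (by simp)) ?_
    filter_upwards [continuous_re.continuousAt.eventually (lt_mem_nhds (by simp : 0 < (1 : ℂ).re))]
      with w hw
    rw [hG.eq_of_re_pos w hw, hH.eq_of_re_pos w hw]
  have h1 := (hG.boundary y hp).tendsto.comp (tendsto_add_mul_I hβ y)
  have h2 := (hH.boundary y hp).tendsto.comp (tendsto_add_mul_I hβ y)
  refine tendsto_nhds_unique h1 (h2.congr' ?_)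
  filter_upwards [eventually_add_mul_I_mem hβ y] with ε hε
  exact (hon hε).symm

/-- If no cut is crossed, the cuts in direction `β` can be replaced by horizontal ones. -/
theorem floor_latticeCoord_eq {β y : ℂ} (hβ : 0 < β.re) (hy : y.re < 0)
    (h : β.im = 0 ∨ ∀ (n : ℤ) (a b : ℝ), 0 ≤ a → 0 ≤ b →
      y ≠ 2 * (Real.pi : ℂ) * I * (n : ℂ) - ((a : ℂ) + (b : ℂ) * β)) :
    ⌊latticeCoord β y⌋ = ⌊y.im / (2 * Real.pi)⌋ := by
  have hpi := Real.pi_pos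
  rcases h with h | h
  · simp [latticeCoord, h]
  set u := latticeCoord β y with hu
  set v := y.im / (2 * Real.pi) with hv
  have huv : 2 * Real.pi * u = y.im - y.re * β.im / β.re := by
    rw [hu]; unfold latticeCoord; field_simp
  have hv' : 2 * Real.pi * v = y.im := by rw [hv]; field_simp
  -- An integer `n = r u + (1 - r) v` would put `y` at `2πin - a - bβ` with `a = -(1 - r) Re y` and
  -- `b = -r Re y / Re β`. Different floors would force such an integer between `u` and `v`.
  have key : ∀ (n : ℤ) (r : ℝ), 0 ≤ r → r ≤ 1 → (n : ℝ) ≠ r * u + (1 - r) * v := by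
    intro n r h0 h1 hn
    refine h n (-y.re * (1 - r)) (-y.re * r / β.re) (mul_nonneg (by linarith) (by linarith))
      (div_nonneg (mul_nonneg (by linarith) h0) hβ.le) ?_
    have him : 2 * Real.pi * (n : ℝ) = y.im - r * (y.re * β.im / β.re) := by
      rw [hn]; linear_combination r * huv + (1 - r) * hv'
    apply Complex.ext
    · simp; field_simp; ring
    · simp; rw [him]; ring
  by_contra hne
  rcases lt_or_gt_of_ne hne with hlt | hlt
  · have h1 : u < ⌊v⌋ := Int.floor_lt.1 hlt
    have h2 := Int.floor_le v
    have h3 : 0 < v - u := by linarith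
    refine key ⌊v⌋ ((v - ⌊v⌋) / (v - u)) (div_nonneg (by linarith) h3.le)
      (by rw [div_le_one h3]; linarith) ?_
    field_simp; ring
  · have h1 : v < ⌊u⌋ := Int.floor_lt.1 hlt
    have h2 := Int.floor_le u
    have h3 : 0 < u - v := by linarith
    refine key ⌊u⌋ ((⌊u⌋ - v) / (u - v)) (div_nonneg (by linarith) h3.le)
      (by rw [div_le_one h3]; linarith) ?_
    field_simp; ring

/-! ### The elementary part and its difference equation. -/

theorem sinh_half_ne_zero {y : ℂ} (hp : y ∉ periods) : sinh (y / 2) ≠ 0 := by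
  intro h
  apply exp_sub_one_ne_zero hp
  have h1 : exp y = exp (y / 2) * exp (y / 2) := by rw [← exp_add]; ring_nf
  have h2 : exp (y / 2) * exp (-(y / 2)) = 1 := by rw [← exp_add]; simp
  rw [Complex.sinh] at h
  rw [h1]
  linear_combination 2 * exp (y / 2) * h + h2

theorem coth_half {y : ℂ} (hp : y ∉ periods) : coth (y / 2) = 1 + 2 / (exp y - 1) := by
  have h0 := sinh_half_ne_zero hp
  have h1 : exp y = exp (y / 2) * exp (y / 2) := by rw [← exp_add]; ring_nf
  have h2 : exp (y / 2) * exp (-(y / 2)) = 1 := by rw [← exp_add]; simp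
  have h3 := exp_sub_one_ne_zero hp
  have h4 : 2 * (exp (y / 2) * sinh (y / 2)) = exp y - 1 := by
    rw [Complex.sinh, h1]; linear_combination -h2
  have h5 : 2 * (exp (y / 2) * cosh (y / 2)) = exp y + 1 := by
    rw [Complex.cosh, h1]; linear_combination h2
  have h6 := exp_ne_zero (y / 2)
  have h7 : coth (y / 2) = (exp y + 1) / (exp y - 1) := by
    rw [coth, ← h4, ← h5]; field_simp
  rw [h7]; field_simp; ring

/-- The elementary part of the logarithm of the `q`-Pochhammer symbol. -/
def mainPart (β y : ℂ) : ℂ :=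
  -dilogBranch β y / β + logBranch β y / 2 + β * (1 - coth (y / 2)) / 24

theorem mainPart_eq {β y : ℂ} (hp : y ∉ periods) : mainPart β y =
    -dilogBranch β y / β + logBranch β y / 2 - β / 12 * (1 / (exp y - 1)) := by
  rw [mainPart, coth_half hp]; ring

/-- Euler–Maclaurin along `y + tβ`: the primitive gives the dilogarithm, the endpoint average the
half logarithm, and the first derivative the `coth` term. -/
theorem integral_emKernel_logBranch {β y : ℂ} (hβ : 0 < β.re) (hy : y ∈ cutPlane β) :
    ∫ t in (0 : ℝ)..1, (emKernel t : ℂ) * (β ^ 3 * (exp (-(y + t * β)) *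
      (1 + exp (-(y + t * β))) / (1 - exp (-(y + t * β))) ^ 3)) =
      logBranch β y - mainPart β y + mainPart β (y + β) := by
  have hβ0 : β ≠ 0 := fun h => by simp [h] at hβ
  have hm : ∀ t ∈ Icc (0 : ℝ) 1, y + t * β ∈ cutPlane β := fun t ht => add_mem_cutPlane hy ht.1
  have hd : ∀ t : ℝ, HasDerivAt (fun t : ℝ => y + (t : ℂ) * β) β t := fun t => by
    simpa using (((hasDerivAt_id (t : ℂ)).mul_const β).const_add y).comp_ofReal
  have hne : ∀ t ∈ Icc (0 : ℝ) 1, exp (y + t * β) - 1 ≠ 0 := fun t ht =>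
    exp_sub_one_ne_zero (notMem_periods_of_mem_cutPlane β (hm t ht))
  have he : ∀ t : ℝ, HasDerivAt (fun t : ℝ => exp (y + (t : ℂ) * β))
      (exp (y + (t : ℂ) * β) * β) t := fun t => (hd t).cexp
  rw [integral_emKernel_mul (Φ := fun t => dilogBranch β (y + t * β) / β)
    (φ := fun t => logBranch β (y + t * β)) (φ₁ := fun t => 1 / (exp (y + t * β) - 1) * β)
    (φ₂ := fun t => -β ^ 2 * (exp (y + t * β) / (exp (y + t * β) - 1) ^ 2))]
  · have hp0 := notMem_periods_of_mem_cutPlane β hy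
    have hp1 := notMem_periods_of_mem_cutPlane β (add_mem_cutPlane hy zero_le_one)
    rw [ofReal_one, one_mul] at hp1
    rw [mainPart_eq hp0, mainPart_eq hp1]
    simp only [ofReal_one, ofReal_zero, one_mul, zero_mul, add_zero]
    ring
  · intro t ht
    have := ((hasDerivAt_branches hβ (hm t ht)).2.comp_of_eq t (hd t) rfl).div_const β
    refine this.congr_deriv ?_
    field_simp
  · intro t ht
    exact (hasDerivAt_branches hβ (hm t ht)).1.comp_of_eq t (hd t) rfl
  · intro t ht
    have h0 := hne t ht
    refine (((hasDerivAt_const t (1 : ℂ)).fun_div ((he t).sub_const 1) h0).mul_const β).congr_deriv ?_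
    field_simp
    ring
  · intro t ht
    have h0 := hne t ht
    refine (((he t).fun_div (((he t).sub_const 1).pow 2) (pow_ne_zero 2 h0)).const_mul
      (-β ^ 2)).congr_deriv ?_
    have h1 := exp_ne_zero (y + t * β)
    rw [exp_neg]
    have h2 : 1 - (exp (y + t * β))⁻¹ = (exp (y + t * β) - 1) / exp (y + t * β) := by field_simp
    rw [h2]
    simp only [Pi.pow_apply]
    generalize exp (y + t * β) = E at *
    field_simp
    push_cast
    ring
  · refine ContinuousOn.mul continuousOn_const (ContinuousOn.div (by fun_prop) (by fun_prop)
      fun t ht => pow_ne_zero 3 (sub_ne_zero.2 ?_))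
    exact (exp_neg_ne_one (notMem_periods_of_mem_cutPlane β (hm t ht))).symm

/-- The difference equation of the elementary part. -/
theorem hasSum_stirlingStep_node {β y : ℂ} (hβ : 0 < β.re) (hy : y ∈ cutPlane β) :
    HasSum (fun n : ℤ => stirlingStep (node β y n))
      (mainPart β y - mainPart β (y + β) - logBranch β y) := by
  have hβ0 : β ≠ 0 := fun h => by simp [h] at hβ
  have hβn : 0 < ‖β‖ := norm_pos_iff.2 hβ0
  obtain ⟨c, hc, hb⟩ := exists_mul_le_norm_of_mem_cutPlane hβ hy
  have key := intervalIntegral.hasSum_integral_of_dominated_convergence (μ := volume) (a := 0)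
    (b := 1) (F := fun (n : ℤ) (t : ℝ) => (emKernel t : ℂ) * (2 / (node β y n + t) ^ 3))
    (f := fun t : ℝ => (emKernel t : ℂ) * (β ^ 3 * (exp (-(y + t * β)) *
      (1 + exp (-(y + t * β))) / (1 - exp (-(y + t * β))) ^ 3)))
    (fun n _ => (‖β‖ / c) ^ 3 * (1 / (1 + |(n : ℝ)|) ^ 3)) (fun n => ?_) (fun n => ?_) ?_
    intervalIntegrable_const ?_
  · rw [integral_emKernel_logBranch hβ hy] at key
    have h := key.neg
    rw [show mainPart β y - mainPart β (y + β) - logBranch β y =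
      -(logBranch β y - mainPart β y + mainPart β (y + β)) by ring]
    refine h.congr_fun fun n => ?_
    exact stirlingStep_eq_integral (node_mem_slitPlane hβ0 hy n)
  · have := continuous_emKernel.measurable
    exact Measurable.aestronglyMeasurable (by fun_prop)
  · refine Eventually.of_forall fun t ht => ?_
    rw [uIoc_of_le zero_le_one] at ht
    have h1 := hb n t ht.1.le
    have h2 := abs_emKernel_le ⟨ht.1.le, ht.2⟩
    rw [node_add hβ0, norm_mul, norm_div, norm_pow, norm_div, norm_real, Real.norm_eq_abs,
      Complex.norm_ofNat]
    have h3 : c * (1 + |(n : ℝ)|) ≤ ‖y + 2 * (Real.pi : ℂ) * I * (n : ℂ) + t * β‖ := by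
      exact (mul_le_mul_of_nonneg_left (by linarith [ht.1]) hc.le).trans h1
    calc _ ≤ 1 / 2 * (2 / (c * (1 + |(n : ℝ)|) / ‖β‖) ^ 3) := by gcongr
      _ = _ := by field_simp
  · exact Eventually.of_forall fun t _ => summable_one_div_one_add_abs_pow.mul_left _
  -- The only excluded `t` is the one for which `y + tβ` is purely imaginary.
  · filter_upwards [Measure.ae_ne volume (-(y.re / β.re))] with t ht _
    have hre : (y + t * β).re ≠ 0 := by
      intro h
      rw [add_re, re_ofReal_mul] at h
      apply ht
      field_simp
      linarith
    refine (((hasSum_inv_cube hre).mul_left (β ^ 3)).congr_fun fun n => ?_).mul_left _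
    rw [node_add hβ0, div_pow]
    rw [show y + t * β + 2 * (Real.pi : ℂ) * I * (n : ℂ) =
      y + 2 * (Real.pi : ℂ) * I * (n : ℂ) + t * β by ring]
    rw [div_div_eq_mul_div]
    ring

/-! ### Telescoping in `k` and the formulas on the cut plane. -/

theorem norm_exp_neg_lt_one {β : ℂ} (hβ : 0 < β.re) : ‖exp (-β)‖ < 1 := by
  rw [norm_exp]; simpa using hβ

theorem exp_neg_add_nat_mul (β y : ℂ) (k : ℕ) :
    exp (-(y + k * β)) = exp (-y) * exp (-β) ^ k := by
  rw [← exp_nat_mul, ← exp_add]; ring_nf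

theorem tendsto_exp_neg_add_nat_mul {β : ℂ} (hβ : 0 < β.re) (y : ℂ) :
    Tendsto (fun k : ℕ => exp (-(y + k * β))) atTop (𝓝 0) := by
  simp_rw [exp_neg_add_nat_mul]
  simpa using (tendsto_pow_atTop_nhds_zero_of_norm_lt_one (norm_exp_neg_lt_one hβ)).const_mul
    (exp (-y))

theorem eventually_re_nonneg {β : ℂ} (hβ : 0 < β.re) (y : ℂ) :
    ∀ᶠ k : ℕ in atTop, 0 ≤ (y + k * β).re := by
  filter_upwards [eventually_ge_atTop ⌈-(y.re / β.re)⌉₊] with k hk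
  have h1 := Nat.ceil_le.1 hk
  have h2 : -(y.re / β.re) * β.re ≤ k * β.re := by gcongr
  rw [neg_mul, div_mul_cancel₀ _ hβ.ne'] at h2
  simp
  linarith

theorem summable_logBranch {β : ℂ} (hβ : 0 < β.re) (y : ℂ) :
    Summable fun k : ℕ => logBranch β (y + k * β) := by
  have hs := ((summable_geometric_of_lt_one (norm_nonneg _) (norm_exp_neg_lt_one hβ)).mul_left
    (3 / 2 * ‖exp (-y)‖))
  refine Summable.of_norm_bounded_eventually_nat hs ?_
  have h0 := (tendsto_exp_neg_add_nat_mul hβ y).norm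
  rw [norm_zero] at h0
  filter_upwards [eventually_re_nonneg hβ y, h0.eventually (gt_mem_nhds one_half_pos)] with k h1 h2
  rw [logBranch_eq_log (Or.inl h1), sub_eq_add_neg]
  refine (norm_log_one_add_half_le_self (by rw [norm_neg]; exact h2.le)).trans_eq ?_
  rw [norm_neg, exp_neg_add_nat_mul, norm_mul, norm_pow, mul_assoc]

/-- Far out, every term is a function of `e^{-(y + kβ)}` that vanishes continuously at `0`; so no
constant survives the telescoping. -/
theorem tendsto_mainPart {β y : ℂ} (hβ : 0 < β.re) (hy : y ∈ cutPlane β) :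
    Tendsto (fun k : ℕ => mainPart β (y + k * β)) atTop (𝓝 0) := by
  have h0 := tendsto_exp_neg_add_nat_mul hβ y
  have h1 := (summable_logBranch hβ y).tendsto_atTop_zero
  have h2 : Tendsto (fun k : ℕ => dilogBranch β (y + k * β)) atTop (𝓝 0) := by
    have h := continuousAt_dilog_zero.tendsto.comp h0
    rw [dilog_zero] at h
    refine h.congr' ?_
    filter_upwards [eventually_re_nonneg hβ y] with k hk
    exact (dilogBranch_eq_dilog (Or.inl hk)).symm
  have h3 : Tendsto (fun k : ℕ => exp (-(y + k * β)) / (1 - exp (-(y + k * β)))) atTop (𝓝 0) := by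
    have h := h0.div (h0.const_sub 1) (by simp)
    rwa [zero_div] at h
  have h4 := ((h2.neg.div_const β).add (h1.div_const 2)).sub (h3.const_mul (β / 12))
  simp only [neg_zero, zero_div, mul_zero, add_zero, sub_zero] at h4
  refine h4.congr fun k => ?_
  have hp := notMem_periods_of_mem_cutPlane β (add_mem_cutPlane hy (Nat.cast_nonneg (α := ℝ) k))
  rw [ofReal_natCast] at hp
  rw [mainPart_eq hp]
  congr 2
  have := exp_sub_one_ne_zero hp
  rw [exp_neg]
  have h5 := exp_ne_zero (y + k * β)
  have h6 : 1 - (exp (y + k * β))⁻¹ = (exp (y + k * β) - 1) / exp (y + k * β) := by field_simp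
  rw [h6]
  field_simp

section CutPlane

variable {β y : ℂ}

theorem node_add_nat_mul (hβ : β ≠ 0) (n : ℤ) (k : ℕ) :
    node β (y + k * β) n = node β y n + k := by
  unfold node; field_simp; ring

theorem summable_stirlingStep_prod (hβ : 0 < β.re) (hy : y ∈ cutPlane β) :
    Summable fun p : ℤ × ℕ => stirlingStep (node β y p.1 + p.2) := by
  have hβ0 : β ≠ 0 := fun h => by simp [h] at hβ
  obtain ⟨c, hc, hb⟩ := exists_mul_le_norm_of_mem_cutPlane hβ hy
  exact Summable.of_norm_bounded (summable_lattice.mul_left ((‖β‖ / c) ^ 3)) fun p =>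
    norm_stirlingStep_node_le hβ0 hc (hb p.1) p.2

theorem hasSum_stirlingRemainder_node (hβ : 0 < β.re) (hy : y ∈ cutPlane β) :
    HasSum (fun n : ℤ => stirlingRemainder (node β y n))
      (∑' p : ℤ × ℕ, stirlingStep (node β y p.1 + p.2)) := by
  have hβ0 : β ≠ 0 := fun h => by simp [h] at hβ
  have h : ∀ n : ℤ, HasSum (fun k : ℕ => stirlingStep (node β y n + k))
      (stirlingRemainder (node β y n)) :=
    fun n => hasSum_stirlingStep (node_mem_slitPlane hβ0 hy n)
  exact (summable_stirlingStep_prod hβ hy).hasSum.prod_fiberwise h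

/-- The logarithmic form of the product formula. -/
theorem tsum_logBranch (hβ : 0 < β.re) (hy : y ∈ cutPlane β) :
    ∑' k : ℕ, logBranch β (y + k * β) =
      mainPart β y - ∑' n : ℤ, stirlingRemainder (node β y n) := by
  have hβ0 : β ≠ 0 := fun h => by simp [h] at hβ
  have hS := (summable_stirlingStep_prod hβ hy).hasSum
  rw [← (hasSum_stirlingRemainder_node hβ hy).tsum_eq] at hS
  have hm : ∀ k : ℕ, y + k * β ∈ cutPlane β := fun k => by
    simpa using add_mem_cutPlane hy (Nat.cast_nonneg (α := ℝ) k)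
  have h1 : HasSum (fun k : ℕ => mainPart β (y + k * β) - mainPart β (y + k * β + β) -
      logBranch β (y + k * β)) (∑' n : ℤ, stirlingRemainder (node β y n)) := by
    -- The double series is now summed over `n` first, where the difference equation applies.
    refine ((Equiv.prodComm ℕ ℤ).hasSum_iff.2 hS).prod_fiberwise fun k => ?_
    refine (hasSum_stirlingStep_node hβ (hm k)).congr_fun fun n => ?_
    simp [node_add_nat_mul hβ0]
  have h2 := h1.add (summable_logBranch hβ y).hasSum
  simp only [sub_add_cancel] at h2
  have h3 : Tendsto (fun N : ℕ => ∑ k ∈ Finset.range N,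
      (mainPart β (y + k * β) - mainPart β (y + k * β + β))) atTop (𝓝 (mainPart β y)) := by
    have := (tendsto_mainPart hβ hy).const_sub (mainPart β y)
    rw [sub_zero] at this
    refine this.congr fun N => ?_
    have h := Finset.sum_range_sub' (fun k : ℕ => mainPart β (y + k * β)) N
    simp only [Nat.cast_zero, zero_mul, add_zero] at h
    rw [← h]
    refine Finset.sum_congr rfl fun k _ => ?_
    push_cast
    rw [show y + (k + 1) * β = y + k * β + β by ring]
  have h4 := tendsto_nhds_unique h3 h2.tendsto_sum_nat
  linear_combination -h4

theorem exp_tsum_logBranch (hβ : 0 < β.re) (hy : y ∈ cutPlane β) :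
    exp (∑' k : ℕ, logBranch β (y + k * β)) = qPochhammer (exp (-y)) (exp (-β)) := by
  rw [qPochhammer, ← (summable_logBranch hβ y).hasSum.cexp.tprod_eq]
  refine tprod_congr fun k => ?_
  have hp := notMem_periods_of_mem_cutPlane β (add_mem_cutPlane hy (Nat.cast_nonneg (α := ℝ) k))
  rw [ofReal_natCast] at hp
  rw [Function.comp, exp_logBranch β hp, exp_neg_add_nat_mul]

theorem hasProd_dressedInvGamma (hβ : 0 < β.re) (hy : y ∈ cutPlane β) :
    HasProd (fun n : ℤ => dressedInvGamma (node β y n))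
      (exp (-∑' n : ℤ, stirlingRemainder (node β y n))) := by
  have hβ0 : β ≠ 0 := fun h => by simp [h] at hβ
  have h := (hasSum_stirlingRemainder_node hβ hy).summable.hasSum.neg.cexp
  refine h.congr_fun fun n => ?_
  exact dressedInvGamma_eq_exp (node_mem_slitPlane hβ0 hy n)

theorem qPochhammer_of_mem_cutPlane (hβ : 0 < β.re) (hy : y ∈ cutPlane β) :
    qPochhammer (exp (-y)) (exp (-β)) =
      exp (β * (1 - coth (y / 2)) / 24 - dilogBranch β y / β) * exp (logBranch β y / 2) *
        ∏' n : ℤ, dressedInvGamma (node β y n) := by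
  rw [← exp_tsum_logBranch hβ hy, tsum_logBranch hβ hy, (hasProd_dressedInvGamma hβ hy).tprod_eq,
    ← exp_add, ← exp_add, mainPart]
  congr 1; ring

end CutPlane

/-! ### Passage to the cuts. -/

/-- `1/Γ` is entire, so only the principal logarithm can jump, and it is continuous from the upper
side of its cut. -/
theorem continuousWithinAt_dressedInvGamma {x : ℂ} (hx : x ≠ 0) :
    ContinuousWithinAt dressedInvGamma {z | 0 ≤ (z - x).im} x := by
  have hlog : ContinuousWithinAt log {z | 0 ≤ (z - x).im} x := by
    by_cases hs : x ∈ slitPlane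
    · exact (continuousAt_clog hs).continuousWithinAt
    rw [mem_slitPlane_iff, not_or, not_lt, not_not] at hs
    have hre : x.re < 0 := lt_of_le_of_ne hs.1 fun h => hx (Complex.ext h hs.2)
    refine (continuousWithinAt_log_of_re_neg_of_im_zero hre hs.2).mono fun z hz => ?_
    simpa [hs.2] using hz
  have hG : ContinuousWithinAt (fun z : ℂ => (Gamma z)⁻¹) {z | 0 ≤ (z - x).im} x :=
    differentiable_one_div_Gamma.continuous.continuousWithinAt
  have hmain : ContinuousWithinAt (fun z : ℂ => (Real.sqrt (2 * Real.pi) : ℂ) * (Gamma z)⁻¹ *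
      exp (log z * (z - 1 / 2)) * exp (1 / (12 * z) - z)) {z | 0 ≤ (z - x).im} x := by
    have h1 : ContinuousWithinAt (fun z : ℂ => 1 / (12 * z) - z) {z | 0 ≤ (z - x).im} x := by
      have : (12 : ℂ) * x ≠ 0 := mul_ne_zero (by norm_num) hx
      fun_prop (disch := assumption)
    exact ((continuousWithinAt_const.mul hG).mul (hlog.mul (by fun_prop)).cexp).mul h1.cexp
  have he : ∀ z : ℂ, z ≠ 0 → dressedInvGamma z = (Real.sqrt (2 * Real.pi) : ℂ) * (Gamma z)⁻¹ *
      exp (log z * (z - 1 / 2)) * exp (1 / (12 * z) - z) := by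
    intro z hz
    rw [dressedInvGamma, cpow_def_of_ne_zero hz, div_eq_mul_inv]
  refine hmain.congr_of_eventuallyEq ?_ (he x hx)
  filter_upwards [nhdsWithin_le_nhds (isOpen_ne.mem_nhds hx)] with z hz using he z hz

theorem continuous_qPochhammer {q : ℂ} (hq : ‖q‖ < 1) : Continuous fun z => qPochhammer z q := by
  rw [continuous_iff_continuousAt]
  intro z₀
  have hs : Summable fun j : ℕ => (‖z₀‖ + 1) * ‖q‖ ^ j :=
    (summable_geometric_of_lt_one (norm_nonneg q) hq).mul_left _
  have h := (Summable.multipliableUniformlyOn_nat_one_add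
    (isCompact_closedBall (0 : ℂ) (‖z₀‖ + 1)) (f := fun j z => -(z * q ^ j)) hs
    (Eventually.of_forall fun j z hz => by
      rw [mem_closedBall_zero_iff] at hz
      rw [norm_neg, norm_mul, norm_pow]; gcongr)
    (fun j => by fun_prop)).hasProdUniformlyOn.tendstoUniformlyOn_finsetRange
  have hc := h.continuousOn (Eventually.of_forall fun N => by fun_prop).frequently
  have hc' := hc.continuousAt (x := z₀) (Metric.closedBall_mem_nhds_of_mem (by simp))
  simpa [qPochhammer, sub_eq_add_neg] using hc'

section Tail

variable {β y : ℂ} {m : ℤ} {c : ℝ}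

/-- The logarithm of the product over all nodes but the one with index `m`. -/
def tailSum (β : ℂ) (m : ℤ) (y : ℂ) : ℂ :=
  ∑' p : ℤ × ℕ, if p.1 = m then 0 else stirlingStep (node β y p.1 + p.2)

theorem norm_tail_le (hβ : β ≠ 0) (hc : 0 < c) (hb : ∀ n : ℤ, n ≠ m → ∀ s : ℝ, 0 ≤ s →
      c * (1 + |(n : ℝ)| + s) ≤ ‖y + 2 * (Real.pi : ℂ) * I * (n : ℂ) + s * β‖) (p : ℤ × ℕ) :
    ‖if p.1 = m then 0 else stirlingStep (node β y p.1 + p.2)‖ ≤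
      (‖β‖ / c) ^ 3 * (1 / (1 + |(p.1 : ℝ)| + p.2) ^ 3) := by
  split_ifs with h
  · rw [norm_zero]; positivity
  · exact norm_stirlingStep_node_le hβ hc (hb p.1 h) p.2

theorem hasSum_tail (hβ : β ≠ 0) (hc : 0 < c) (hb : ∀ n : ℤ, n ≠ m → ∀ s : ℝ, 0 ≤ s →
      c * (1 + |(n : ℝ)| + s) ≤ ‖y + 2 * (Real.pi : ℂ) * I * (n : ℂ) + s * β‖) :
    HasSum (fun n : ℤ => if n = m then 0 else stirlingRemainder (node β y n))
      (tailSum β m y) := by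
  have hs : Summable fun p : ℤ × ℕ => if p.1 = m then 0 else stirlingStep (node β y p.1 + p.2) :=
    Summable.of_norm_bounded (summable_lattice.mul_left ((‖β‖ / c) ^ 3)) (norm_tail_le hβ hc hb)
  have h : ∀ n : ℤ, HasSum (fun k : ℕ => if n = m then 0 else stirlingStep (node β y n + k))
      (if n = m then 0 else stirlingRemainder (node β y n)) := by
    intro n
    split_ifs with hn
    · exact hasSum_zero
    · exact hasSum_stirlingStep (node_mem_slitPlane_of_bound hβ hc (hb n hn))
  exact hs.hasSum.prod_fiberwise h

/-- The node with index `m` may lie on the negative axis, where `dressedInvGamma` can vanish; its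
factor is kept outside the exponential. -/
theorem hasProd_dressedInvGamma_tail (hβ : β ≠ 0) (hc : 0 < c)
    (hb : ∀ n : ℤ, n ≠ m → ∀ s : ℝ, 0 ≤ s →
      c * (1 + |(n : ℝ)| + s) ≤ ‖y + 2 * (Real.pi : ℂ) * I * (n : ℂ) + s * β‖) :
    HasProd (fun n : ℤ => dressedInvGamma (node β y n))
      (dressedInvGamma (node β y m) * exp (-tailSum β m y)) := by
  refine ((hasProd_ite_eq m (dressedInvGamma (node β y m))).mul
    (hasSum_tail hβ hc hb).neg.cexp).congr_fun fun n => ?_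
  simp only [Function.comp]
  split_ifs with hn
  · simp [hn]
  · rw [one_mul, dressedInvGamma_eq_exp (node_mem_slitPlane_of_bound hβ hc (hb n hn))]

theorem summable_norm_dressedInvGamma_sub_one (hβ : 0 < β.re) (y : ℂ) :
    Summable fun n : ℤ => ‖dressedInvGamma (node β y n) - 1‖ := by
  have hβ0 : β ≠ 0 := fun h => by simp [h] at hβ
  obtain ⟨m, c, hc, hev⟩ := exists_mul_le_norm_of_ne β hβ y
  have hb := hev.self_of_nhds
  have hs := (hasSum_tail hβ0 hc hb).summable
  have h0 := hs.tendsto_cofinite_zero.norm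
  rw [norm_zero] at h0
  rw [summable_norm_iff]
  refine Summable.of_norm_bounded_eventually (hs.norm.mul_left 2) ?_
  filter_upwards [h0.eventually (gt_mem_nhds one_pos), (finite_singleton m).compl_mem_cofinite]
    with n h1 hn
  have hn' : n ≠ m := hn
  rw [if_neg hn'] at h1 ⊢
  rw [dressedInvGamma_eq_exp (node_mem_slitPlane_of_bound hβ0 hc (hb n hn')),
    ← norm_neg (stirlingRemainder _)]
  exact norm_exp_sub_one_le (by rw [norm_neg]; exact h1.le)

/-- The bound for the indices other than `m` is uniform near `y`, so the tail converges by
domination; the one remaining factor is continuous from the chosen side. -/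
theorem tendsto_tprod_dressedInvGamma (hβ : 0 < β.re) (hy : y ∉ periods) :
    Tendsto (fun w => ∏' n : ℤ, dressedInvGamma (node β w n))
      (𝓝[{w | 0 ≤ ((w - y) / β).im}] y) (𝓝 (∏' n : ℤ, dressedInvGamma (node β y n))) := by
  have hβ0 : β ≠ 0 := fun h => by simp [h] at hβ
  obtain ⟨m, c, hc, hev⟩ := exists_mul_le_norm_of_ne β hβ y
  have hb := hev.self_of_nhds
  have hnode : ∀ n : ℤ, Continuous fun w => node β w n := fun n => by unfold node; fun_prop
  rw [(hasProd_dressedInvGamma_tail hβ0 hc hb).tprod_eq]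
  have htail : Tendsto (tailSum β m) (𝓝 y) (𝓝 (tailSum β m y)) := by
    refine tendsto_tsum_of_dominated_convergence (summable_lattice.mul_left ((‖β‖ / c) ^ 3))
      (fun p => ?_) (hev.mono fun w hw => norm_tail_le hβ0 hc hw)
    by_cases h : p.1 = m
    · simp [h]
    · simp only [if_neg h]
      have h1 := add_natCast_mem_slitPlane (node_mem_slitPlane_of_bound hβ0 hc (hb p.1 h)) p.2
      exact ((continuousAt_stirlingStep h1).comp (f := fun w => node β w p.1 + p.2)
        ((hnode p.1).add continuous_const).continuousAt).tendsto
  have hne : node β y m ≠ 0 := by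
    intro h
    rw [node, div_eq_zero_iff, or_iff_left hβ0] at h
    exact hy ⟨-m, by push_cast; linear_combination h⟩
  have hhead : Tendsto (fun w => dressedInvGamma (node β w m))
      (𝓝[{w | 0 ≤ ((w - y) / β).im}] y) (𝓝 (dressedInvGamma (node β y m))) := by
    refine (continuousWithinAt_dressedInvGamma hne).tendsto.comp (tendsto_nhdsWithin_iff.2
      ⟨((hnode m).tendsto y).mono_left nhdsWithin_le_nhds, ?_⟩)
    filter_upwards [self_mem_nhdsWithin] with w hw
    have : node β w m - node β y m = (w - y) / β := by unfold node; ring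
    rw [this]
    exact hw
  refine (hhead.mul ((continuous_exp.tendsto _).comp
    (htail.mono_left nhdsWithin_le_nhds).neg)).congr' ?_
  filter_upwards [nhdsWithin_le_nhds hev] with w hw
  exact (hasProd_dressedInvGamma_tail hβ0 hc hw).tprod_eq.symm

end Tail

/-- The product formula, including the points on the cuts. -/
theorem qPochhammer_eq {β y : ℂ} (hβ : 0 < β.re) (hy : y ∉ periods) :
    qPochhammer (exp (-y)) (exp (-β)) =
      exp (β * (1 - coth (y / 2)) / 24 - dilogBranch β y / β) * exp (logBranch β y / 2) *
        ∏' n : ℤ, dressedInvGamma (node β y n) := by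
  have ht := tendsto_add_mul_I hβ y
  have hq : Continuous fun w => qPochhammer (exp (-w)) (exp (-β)) :=
    (continuous_qPochhammer (norm_exp_neg_lt_one hβ)).comp (by fun_prop)
  have hcoth : ContinuousAt (fun w => coth (w / 2)) y := by
    unfold coth
    exact ContinuousAt.div (by fun_prop) (by fun_prop) (sinh_half_ne_zero hy)
  have h1 := ((hq.tendsto y).mono_left nhdsWithin_le_nhds).comp ht
  have hD := ((isBranch_dilogBranch hβ).boundary y hy).tendsto
  have hL := ((isBranch_logBranch hβ).boundary y hy).tendsto
  have hC := hcoth.tendsto.mono_left (nhdsWithin_le_nhds (s := {w | 0 ≤ ((w - y) / β).im}))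
  have h2 := ((((((hC.const_sub 1).const_mul β).div_const 24).sub (hD.div_const β)).cexp.mul
    (hL.div_const 2).cexp).mul (tendsto_tprod_dressedInvGamma hβ hy)).comp ht
  -- Both sides have limits along `y + iεβ`, and they agree for small `ε > 0` because these points
  -- lie in the cut plane.
  refine tendsto_nhds_unique h1 (h2.congr' ?_)
  filter_upwards [eventually_add_mul_I_mem hβ y] with ε hε
  exact (qPochhammer_of_mem_cutPlane hβ hε).symm

end QPoch

end

/-! ### The theorem, for arbitrary branches by uniqueness. -/

theorem mainTheorem1 (β : ℂ) (hβ : 0 < β.re) :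
    -- the branches of `log (1 - e^{-y})` and `Li₂(e^{-y})` exist
    (∃ L : ℂ → ℂ, QPoch.IsBranch β (fun y => Complex.log (1 - Complex.exp (-y))) L) ∧
    (∃ D : ℂ → ℂ, QPoch.IsBranch β (fun y => QPoch.dilogSeries (Complex.exp (-y))) D) ∧
    ∀ L D : ℂ → ℂ,
      QPoch.IsBranch β (fun y => Complex.log (1 - Complex.exp (-y))) L →
      QPoch.IsBranch β (fun y => QPoch.dilogSeries (Complex.exp (-y))) D →
      -- the product identity, with an absolutely convergent product
      (∀ y : ℂ, y ∉ QPoch.periods →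
        Complex.exp (L y) = 1 - Complex.exp (-y) ∧
        Summable (fun n : ℤ => ‖QPoch.dressedInvGamma (QPoch.node β y n) - 1‖) ∧
        Multipliable (fun n : ℤ => QPoch.dressedInvGamma (QPoch.node β y n)) ∧
        QPoch.qPochhammer (Complex.exp (-y)) (Complex.exp (-β)) =
          Complex.exp (β * (1 - QPoch.coth (y / 2)) / 24 - D y / β) * Complex.exp (L y / 2) *
            ∏' n : ℤ, QPoch.dressedInvGamma (QPoch.node β y n)) ∧
      -- the logarithmic form
      (∀ y ∈ QPoch.cutPlane β,
        Summable (fun k : ℕ => L (y + (k : ℂ) * β)) ∧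
        Complex.exp (∑' k : ℕ, L (y + (k : ℂ) * β)) =
          QPoch.qPochhammer (Complex.exp (-y)) (Complex.exp (-β)) ∧
        Summable (fun n : ℤ => ‖QPoch.stirlingRemainder (QPoch.node β y n)‖) ∧
        Complex.exp (-∑' n : ℤ, QPoch.stirlingRemainder (QPoch.node β y n)) =
          ∏' n : ℤ, QPoch.dressedInvGamma (QPoch.node β y n) ∧
        ∑' k : ℕ, L (y + (k : ℂ) * β) =
          -D y / β + L y / 2 + β * (1 - QPoch.coth (y / 2)) / 24
            - ∑' n : ℤ, QPoch.stirlingRemainder (QPoch.node β y n)) ∧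
      -- where no cut is crossed, all branches are the principal ones
      (∀ y : ℂ, y ∉ QPoch.periods →
        (β.im = 0 ∨ ∀ (n : ℤ) (a b : ℝ), 0 ≤ a → 0 ≤ b →
          y ≠ 2 * (Real.pi : ℂ) * Complex.I * (n : ℂ) - ((a : ℂ) + (b : ℂ) * β)) →
        L y = Complex.log (1 - Complex.exp (-y)) ∧
        D y = QPoch.dilog (Complex.exp (-y)) ∧
        QPoch.qPochhammer (Complex.exp (-y)) (Complex.exp (-β)) =
          Complex.exp (β * (1 - QPoch.coth (y / 2)) / 24
              - QPoch.dilog (Complex.exp (-y)) / β) *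
            (1 - Complex.exp (-y)) ^ (1 / 2 : ℂ) *
            ∏' n : ℤ, QPoch.dressedInvGamma (QPoch.node β y n)) := by
  refine ⟨⟨_, QPoch.isBranch_logBranch hβ⟩, ⟨_, QPoch.isBranch_dilogBranch hβ⟩,
    fun L D hL hD => ?_⟩
  have eL : ∀ y : ℂ, y ∉ QPoch.periods → L y = QPoch.logBranch β y := fun y hy =>
    hL.eq hβ (QPoch.isBranch_logBranch hβ) hy
  have eD : ∀ y : ℂ, y ∉ QPoch.periods → D y = QPoch.dilogBranch β y := fun y hy =>
    hD.eq hβ (QPoch.isBranch_dilogBranch hβ) hy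
  refine ⟨fun y hy => ?_, fun y hy => ?_, fun y hy h => ?_⟩
  · have hs := QPoch.summable_norm_dressedInvGamma_sub_one hβ y
    refine ⟨?_, hs, ?_, ?_⟩
    · rw [eL y hy, QPoch.exp_logBranch β hy]
    · simpa using multipliable_one_add_of_summable hs
    · rw [eL y hy, eD y hy, QPoch.qPochhammer_eq hβ hy]
  · have hk : ∀ k : ℕ, L (y + (k : ℂ) * β) = QPoch.logBranch β (y + (k : ℂ) * β) := fun k =>
      eL _ (QPoch.notMem_periods_of_mem_cutPlane β
        (by simpa using QPoch.add_mem_cutPlane hy (Nat.cast_nonneg (α := ℝ) k)))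
    have hp := QPoch.notMem_periods_of_mem_cutPlane β hy
    simp only [hk, eL y hp, eD y hp]
    exact ⟨QPoch.summable_logBranch hβ y, QPoch.exp_tsum_logBranch hβ hy,
      (QPoch.hasSum_stirlingRemainder_node hβ hy).summable.norm,
      (QPoch.hasProd_dressedInvGamma hβ hy).tprod_eq.symm, QPoch.tsum_logBranch hβ hy⟩
  · have hf : 0 ≤ y.re ∨ ⌊QPoch.latticeCoord β y⌋ = ⌊y.im / (2 * Real.pi)⌋ :=
      (le_or_gt 0 y.re).imp_right fun hre => QPoch.floor_latticeCoord_eq hβ hre h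
    have h1 : L y = Complex.log (1 - Complex.exp (-y)) := by
      rw [eL y hy, QPoch.logBranch_eq_log hf]
    have h2 : D y = QPoch.dilog (Complex.exp (-y)) := by
      rw [eD y hy, QPoch.dilogBranch_eq_dilog hf]
    refine ⟨h1, h2, ?_⟩
    rw [QPoch.qPochhammer_eq hβ hy, ← eL y hy, ← eD y hy, h1, h2, Complex.cpow_def_of_ne_zero
      (sub_ne_zero.2 (QPoch.exp_neg_ne_one hy).symm), mul_one_div]
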